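/- Let $(X,d)$ be a complete metric space with a Borel measure $\mu$ that is doubling: $0<\mu(B)<\infty$ for every open ball $B$ of positive radius, and there is $C_D\ge 1$ with $\mu(2B)\le C_D\,\mu(B)$ for every such ball ($\lambda B$ denotes the ball with the same center and $\lambda$ times the radius). **Curves.** A curve is a continuous, rectifiable, non-constant map $\gamma:[a,b]\to X$ of a compact interval, $\ell(\gamma)$ is its length, $\int_\gamma\rho\,ds$ is the path integral in the arc-length parametrization, and for a Borel set $A$ we put $\ell(\gamma\cap A)=\mathcal H^1(\gamma([a,b])\cap A)$. **Semmes pencil.** $X$ supports a Semmes pencil of curves if there is $C>0$ such that for all $x\neq y$ in $X$ there are a family $\Gamma_{xy}$ of curves and a probability measure $\sigma_{xy}$ on $\Gamma_{xy}$ such that each $\gamma\in\Gamma_{xy}$ joins $x$ to $y$ and has $\ell(\gamma)\le C\,d(x,y)$, and such that for every Borel set $A\subset X$ the map $\gamma\mapsto \ell(\gamma\cap A)$ is $\sigma_{xy}$-measurable and $$\int_{\Gamma_{xy}}\ell(\gamma\cap A)\,d\sigma_{xy}(\gamma)\le C\int_{CB_{x,y}\cap A}\left(\frac{d(x,z)}{\mu(B(x,d(x,z)))}+\frac{d(y,z)}{\mu(B(y,d(y,z)))}\right)d\mu(z),$$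 where $CB_{x,y}=B(x,C\,d(x,y))\cup B(y,C\,d(x,y))$. **$BV_{AM}$-upper bounds.** The AM-modulus of a family $\Gamma$ of curves is $$AM(\Gamma)=\inf_{(\rho_i)}\ \liminf_{i\to\infty}\int_X\rho_i\,d\mu ,$$ the infimum being over all sequences of Borel functions $\rho_i:X\to[0,\infty]$ with $\liminf_{i\to\infty}\int_\gamma\rho_i\,ds\ge 1$ for every $\gamma\in\Gamma$. A sequence $(g_i)$ of non-negative Borel functions in $L^1(X)$ is a $BV_{AM}$-upper bound of $u:X\to\mathbb R$ if $\liminf_{i\to\infty}\int_X g_i\,d\mu<\infty$ and there is a family $\Gamma$ of curves with $AM(\Gamma)=0$ such that every curve $\gamma\notin\Gamma$, parametrized by arc length on $[0,\ell(\gamma)]$, satisfies $$|u(\gamma(t))-u(\gamma(s))|\le\liminf_{i\to\infty}\int_{\gamma|_{[s,t]}}g_i\,ds$$ for all $s<t$ in $[0,\ell(\gamma)]$ outside a Lebesgue null set depending on $\gamma$. **Proposition.** If $X$ supports a Semmes pencil of curves, then $X$ supports the AM-Poincaré inequality: there are constants $C>0$ and $\lambda\ge 1$ such that for every $\mu$-measurable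 $u:X\to\mathbb R$, every $BV_{AM}$-upper bound $(g_i)$ of $u$ and every ball $B\subset X$ of radius $r>0$, the function $u$ is integrable on $B$ and, with $u_B=\frac1{\mu(B)}\int_B u\,d\mu$, $$\frac1{\mu(B)}\int_B|u-u_B|\,d\mu\le C\,r\,\liminf_{i\to\infty}\frac1{\mu(\lambda B)}\int_{\lambda B}g_i\,d\mu .$$ -/

import Mathlib

open MeasureTheory Set Filter Metric
open scoped ENNReal Topology

noncomputable section

/-- A non-constant rectifiable curve `γ : [a, b] → X`, `[a, b]` a compact interval.
(Only the values of `toFun` on `[a, b]` matter.) -/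
structure RectCurve (X : Type*) [MetricSpace X] where
  a : ℝ
  b : ℝ
  le : a ≤ b
  toFun : ℝ → X
  continuousOn : ContinuousOn toFun (Icc a b)
  rectifiable : eVariationOn toFun (Icc a b) ≠ ∞
  nonconstant : ∃ s ∈ Icc a b, ∃ t ∈ Icc a b, toFun s ≠ toFun t

namespace RectCurve

variable {X : Type*} [MetricSpace X]

/-- The length of `γ`, i.e. its total variation. -/
def length (γ : RectCurve X) : ℝ≥0∞ := eVariationOn γ.toFun (Icc γ.a γ.b)

/-- The trajectory (image) of `γ`. -/
def trace (γ : RectCurve X) : Set X := γ.toFun '' Icc γ.a γ.b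

/-- The arc-length parametrization of `γ`; its domain is `[0, length γ]`. -/
def arc (γ : RectCurve X) : ℝ → X :=
  naturalParameterization γ.toFun (Icc γ.a γ.b) γ.a

/-- The path integral `∫_γ ρ ds` of a non-negative function, computed in the arc-length
parametrization. -/
def pathIntegral (γ : RectCurve X) (ρ : X → ℝ≥0∞) : ℝ≥0∞ :=
  ∫⁻ r in Icc 0 γ.length.toReal, ρ (γ.arc r)

/-- The path integral of `ρ` over the subcurve of `γ` between the arc-length parameters
`s` and `t`. -/
def subpathIntegral (γ : RectCurve X) (s t : ℝ) (ρ : X → ℝ≥0∞) : ℝ≥0∞ :=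
  ∫⁻ r in Icc s t, ρ (γ.arc r)

end RectCurve

section Definitions

variable {X : Type*} [MetricSpace X] [MeasurableSpace X]

/-- `μ` is a doubling measure; as usual balls have positive and finite measure. -/
def IsDoublingMeasure (μ : Measure X) : Prop :=
  (∀ (x : X) (r : ℝ), 0 < r → 0 < μ (ball x r) ∧ μ (ball x r) < ∞) ∧
  ∃ C : ℝ, 1 ≤ C ∧ ∀ (x : X) (r : ℝ), 0 < r →
    μ (ball x (2 * r)) ≤ ENNReal.ofReal C * μ (ball x r)

/-- The sequences `(ρ_i)` of non-negative Borel functions that are admissible for the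
AM-modulus of the curve family `Γ`. -/
def AMAdmissible (Γ : Set (RectCurve X)) : Set (ℕ → X → ℝ≥0∞) :=
  {ρ | (∀ i, Measurable (ρ i)) ∧
    ∀ γ ∈ Γ, 1 ≤ liminf (fun i => γ.pathIntegral (ρ i)) atTop}

/-- The approximate modulus `AM(Γ)` of a family of curves. -/
def AMModulus (μ : Measure X) (Γ : Set (RectCurve X)) : ℝ≥0∞ :=
  ⨅ ρ ∈ AMAdmissible Γ, liminf (fun i => ∫⁻ z, ρ i z ∂μ) atTop

/-- `(g_i)` is a `BV_AM`-upper bound of `u`: the `g_i` are non-negative Borel functions in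
`L¹(X)` with `liminf ∫ g_i < ∞`, and off a family of curves of zero AM-modulus every curve `γ`,
in its arc-length parametrization, has a Lebesgue null set `N` of parameters such that
`|u(γ(t)) - u(γ(s))| ≤ liminf ∫_{γ|[s,t]} g_i ds` for all parameters `s < t` off `N`. -/
def IsBVAMUpperBound (μ : Measure X) (u : X → ℝ) (g : ℕ → X → ℝ≥0∞) : Prop :=
  (∀ i, Measurable (g i) ∧ ∫⁻ z, g i z ∂μ < ∞) ∧
  (∃ Γ : Set (RectCurve X), AMModulus μ Γ = 0 ∧
    ∀ γ : RectCurve X, γ ∉ Γ →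
      ∃ N : Set ℝ, volume N = 0 ∧
        ∀ s ∈ Icc 0 γ.length.toReal \ N, ∀ t ∈ Icc 0 γ.length.toReal \ N, s < t →
          ENNReal.ofReal |u (γ.arc t) - u (γ.arc s)| ≤
            liminf (fun i => γ.subpathIntegral s t (g i)) atTop) ∧
  liminf (fun i => ∫⁻ z, g i z ∂μ) atTop < ∞

/-- `(X, d, μ)` supports an AM-Poincaré inequality. The inequality is between extended
non-negative numbers, so nothing is lost if an integral is infinite; that `u` is integrable on
the ball, so that its average there makes sense, is part of the assertion. -/
def SupportsAMPoincare (μ : Measure X) : Prop :=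
  ∃ C lam : ℝ, 0 < C ∧ 1 ≤ lam ∧
    ∀ (u : X → ℝ) (g : ℕ → X → ℝ≥0∞), AEMeasurable u μ → IsBVAMUpperBound μ u g →
      ∀ (x : X) (r : ℝ), 0 < r →
        IntegrableOn u (ball x r) μ ∧
        ⨍⁻ z in ball x r, ENNReal.ofReal |u z - ⨍ w in ball x r, u w ∂μ| ∂μ ≤
          ENNReal.ofReal (C * r) *
            liminf (fun i => ⨍⁻ z in ball x (lam * r), g i z ∂μ) atTop

/-- The Riesz kernel `R_{xy}(z) = d(x,z)/μ(B(x,d(x,z))) + d(y,z)/μ(B(y,d(y,z)))`.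
(A summand is `0` at its own pole.) -/
def rieszKernel (μ : Measure X) (x y z : X) : ℝ≥0∞ :=
  ENNReal.ofReal (dist x z) / μ (ball x (dist x z)) +
    ENNReal.ofReal (dist y z) / μ (ball y (dist y z))

/-- The set `C B_{x,y} = B(x, C d(x,y)) ∪ B(y, C d(x,y))`. -/
def twoBalls (C : ℝ) (x y : X) : Set X :=
  ball x (C * dist x y) ∪ ball y (C * dist x y)

/-- `(X, d, μ)` supports a Semmes pencil of curves. Here `ℓ(γ ∩ A)` is the one-dimensional
Hausdorff measure of the part of the trajectory of `γ` in `A`, and measurability with respect to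
`σ` is measurability with respect to the completion of `σ`. -/
def SupportsSemmesPencil [BorelSpace X] (μ : Measure X) : Prop :=
  ∃ C : ℝ, 0 < C ∧ ∀ x y : X, x ≠ y →
    ∃ (Γ : Set (RectCurve X)) (_ : MeasurableSpace Γ) (σ : Measure Γ),
      IsProbabilityMeasure σ ∧
      (∀ γ ∈ Γ, γ.toFun γ.a = x ∧ γ.toFun γ.b = y ∧
        γ.length ≤ ENNReal.ofReal (C * dist x y)) ∧
      ∀ A : Set X, MeasurableSet A →
        AEMeasurable (fun γ : Γ => Measure.hausdorffMeasure 1 (γ.1.trace ∩ A)) σ ∧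
        ∫⁻ γ : Γ, Measure.hausdorffMeasure 1 (γ.1.trace ∩ A) ∂σ ≤
          ENNReal.ofReal C * ∫⁻ z in twoBalls C x y ∩ A, rieszKernel μ x y z ∂μ

end Definitions

end

/-!
A curve contains in its trace a shortest curve with the same endpoints, and shortest curves are
simple. Path integrals along simple curves are integrals over the trace against `μH[1]`, so the
pencil inequality, although it only tests lengths, bounds the expected path integral of every
Borel function `ρ` along the simple curves by the sum of the Riesz potentials of `ρ` at `x` and `y`.

Let `u` be approximately continuous at both `x` and `y`. If `μ` has finite lower one-dimensional
density at `x`, then at arbitrarily small scales most curves of the pencil leave the set where `u`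
is far from `u x` while they are still close to `x`; likewise at `y`. For such curves
`|u x - u y|` is bounded, up to a small error, by the path integrals of the upper bound, provided
that the curve is not exceptional; and for almost every pair `(x, y)` the exceptional family is null
for the measure whose density is the Riesz kernel. This gives the pointwise estimate of
`|u x - u y|` by Riesz potentials, and integrating it over pairs of points of a ball yields the
Poincaré inequality.

The lower density is infinite only on a set of vanishing `μH[1]`-measure. Such a set is `μ`-null:
pencil curves spend no length in it, so at a density point of it distances would be too small.
-/

open scoped NNReal MeasureTheory

section Variation

variable {α E : Type*} [LinearOrder α] [TopologicalSpace α] [OrderTopology α] [PseudoEMetricSpace E]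

theorem continuousOn_variationOnFromTo {f : α → E} {s : Set α} (hf : BoundedVariationOn f s)
    (hc : ContinuousOn f s) {a : α} (ha : a ∈ s) : ContinuousOn (variationOnFromTo f s a) s := by
  intro x hx
  have h_right := (ENNReal.tendsto_toReal ENNReal.zero_ne_top).comp
    (hf.tendsto_eVariationOn_Icc_zero_right x ((hc x hx).mono inter_subset_left))
  have h_left := (ENNReal.tendsto_toReal ENNReal.zero_ne_top).comp
    (hf.tendsto_eVariationOn_Icc_zero_left ((hc x hx).mono inter_subset_left))
  have h_sum := (tendsto_const_nhds (x := variationOnFromTo f s a x)).add (h_right.sub h_left)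
  simp only [ENNReal.toReal_zero, sub_zero, add_zero] at h_sum
  refine h_sum.congr' ?_
  filter_upwards [self_mem_nhdsWithin] with t ht
  have h_single {p q : α} (hpq : p ≤ q) : eVariationOn f (s ∩ Icc q p) = 0 :=
    eVariationOn.subsingleton _ fun u hu v hv =>
      le_antisymm ((hu.2.2.trans hpq).trans hv.2.1) ((hv.2.2.trans hpq).trans hu.2.1)
  rw [← variationOnFromTo.add hf.locallyBoundedVariationOn ha hx ht]
  rcases le_total x t with hxt | htx
  · simp [variationOnFromTo.eq_of_le f s hxt, h_single hxt]
  · simp [variationOnFromTo.eq_of_ge f s htx, h_single htx]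

end Variation

namespace RectCurve

variable {X : Type*} [MetricSpace X] (γ : RectCurve X)

theorem left_mem : γ.a ∈ Icc γ.a γ.b := left_mem_Icc.2 γ.le

theorem right_mem : γ.b ∈ Icc γ.a γ.b := right_mem_Icc.2 γ.le

theorem isCompact_trace : IsCompact γ.trace := isCompact_Icc.image_of_continuousOn γ.continuousOn

theorem locallyBoundedVariationOn : LocallyBoundedVariationOn γ.toFun (Icc γ.a γ.b) :=
  BoundedVariationOn.locallyBoundedVariationOn γ.rectifiable

theorem ofReal_length : ENNReal.ofReal γ.length.toReal = γ.length :=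
  ENNReal.ofReal_toReal γ.rectifiable

theorem variationOnFromTo_right :
    variationOnFromTo γ.toFun (Icc γ.a γ.b) γ.a γ.b = γ.length.toReal := by
  rw [variationOnFromTo.eq_of_le _ _ γ.le, inter_self, length]

theorem image_variationOnFromTo :
    variationOnFromTo γ.toFun (Icc γ.a γ.b) γ.a '' Icc γ.a γ.b = Icc 0 γ.length.toReal := by
  have h_mono := variationOnFromTo.monotoneOn γ.locallyBoundedVariationOn γ.left_mem
  have h_cont := continuousOn_variationOnFromTo γ.rectifiable γ.continuousOn γ.left_mem
  rw [← γ.variationOnFromTo_right, ← variationOnFromTo.self γ.toFun (Icc γ.a γ.b) γ.a]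
  exact h_mono.image_Icc_subset.antisymm (intermediate_value_Icc γ.le h_cont)

theorem arc_variationOnFromTo {t : ℝ} (ht : t ∈ Icc γ.a γ.b) :
    γ.arc (variationOnFromTo γ.toFun (Icc γ.a γ.b) γ.a t) = γ.toFun t :=
  edist_eq_zero.1 (edist_naturalParameterization_eq_zero γ.locallyBoundedVariationOn γ.left_mem ht)

theorem arc_zero : γ.arc 0 = γ.toFun γ.a := by
  simpa [variationOnFromTo.self] using γ.arc_variationOnFromTo γ.left_mem

theorem arc_length : γ.arc γ.length.toReal = γ.toFun γ.b := by
  simpa [γ.variationOnFromTo_right] using γ.arc_variationOnFromTo γ.right_mem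

theorem mapsTo_arc : MapsTo γ.arc (Icc 0 γ.length.toReal) γ.trace := by
  rw [← γ.image_variationOnFromTo]
  rintro _ ⟨t, ht, rfl⟩
  exact ⟨t, ht, (γ.arc_variationOnFromTo ht).symm⟩

theorem eVariationOn_arc {s t : ℝ} (hs : 0 ≤ s) (hst : s ≤ t) (ht : t ≤ γ.length.toReal) :
    eVariationOn γ.arc (Icc s t) = ENNReal.ofReal (t - s) := by
  have h_speed :=
    has_unit_speed_naturalParameterization γ.toFun γ.locallyBoundedVariationOn γ.left_mem
  rw [γ.image_variationOnFromTo] at h_speed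
  have h_eq := h_speed (x := s) ⟨hs, hst.trans ht⟩ (y := t) ⟨hs.trans hst, ht⟩
  rw [inter_eq_right.2 (Icc_subset_Icc hs ht)] at h_eq
  simpa using! h_eq

theorem lipschitzOnWith_arc : LipschitzOnWith 1 γ.arc (Icc 0 γ.length.toReal) := by
  intro s hs t ht
  rw [ENNReal.coe_one, one_mul]
  wlog hst : s ≤ t generalizing s t
  · rw [edist_comm, edist_comm s]
    exact this ht hs (le_of_not_ge hst)
  calc edist (γ.arc s) (γ.arc t) ≤ eVariationOn γ.arc (Icc s t) :=
        eVariationOn.edist_le _ (left_mem_Icc.2 hst) (right_mem_Icc.2 hst)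
    _ = ENNReal.ofReal (t - s) := γ.eVariationOn_arc hs.1 hst ht.2
    _ = edist s t := by rw [edist_comm, edist_dist, Real.dist_eq, abs_of_nonneg (sub_nonneg.2 hst)]

/-- A simple curve: its arc-length parametrization is injective, so that its length is the
one-dimensional Hausdorff measure of its trace. -/
def IsSimple : Prop := InjOn γ.arc (Icc 0 γ.length.toReal)

end RectCurve

section SimpleSubcurve

variable {X : Type*}

theorem lipschitzOnWith_Icc_of_Icc_of_Icc [PseudoEMetricSpace X] {f : ℝ → X} {C : ℝ≥0} {a b c : ℝ}
    (hab : LipschitzOnWith C f (Icc a b)) (hbc : LipschitzOnWith C f (Icc b c)) :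
    LipschitzOnWith C f (Icc a c) := by
  intro s hs t ht
  wlog hst : s ≤ t generalizing s t
  · rw [edist_comm, edist_comm s]
    exact this ht hs (le_of_not_ge hst)
  rcases le_total t b with htb | hbt
  · exact hab ⟨hs.1, hst.trans htb⟩ ⟨ht.1, htb⟩
  rcases le_total b s with hbs | hsb
  · exact hbc ⟨hbs, hs.2⟩ ⟨hbt, ht.2⟩
  calc edist (f s) (f t) ≤ edist (f s) (f b) + edist (f b) (f t) := edist_triangle _ _ _
    _ ≤ C * edist s b + C * edist b t :=
        add_le_add (hab ⟨hs.1, hsb⟩ ⟨hs.1.trans hsb, le_rfl⟩)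
          (hbc ⟨le_rfl, hbt.trans ht.2⟩ ⟨hbt, ht.2⟩)
    _ = C * edist s t := by
        rw [← mul_add, edist_comm s b, edist_comm b t, edist_comm s t]
        simp only [edist_dist, Real.dist_eq]
        rw [← ENNReal.ofReal_add (abs_nonneg _) (abs_nonneg _), abs_of_nonneg (sub_nonneg.2 hsb),
          abs_of_nonneg (sub_nonneg.2 hbt), abs_of_nonneg (sub_nonneg.2 hst)]
        ring_nf

/-- The points `x` and `y` are joined inside `K` by a curve of length at most `L`. The curve is
parametrized on the unit interval, so that `L` is a Lipschitz constant, and extended to `ℝ`. -/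
def JoinedByLipschitz [PseudoEMetricSpace X] (K : Set X) (x y : X) (L : ℝ≥0) : Prop :=
  ∃ f : ℝ → X, LipschitzWith L f ∧ (∀ t, f t ∈ K) ∧ f 0 = x ∧ f 1 = y

namespace JoinedByLipschitz

theorem exists_isLeast [MetricSpace X] {K : Set X} (hK : IsCompact K) {x y : X} {M : ℝ≥0}
    (hM : JoinedByLipschitz K x y M) : ∃ L, IsLeast {L | JoinedByLipschitz K x y L} L := by
  have h_closed : IsClosed {p : ℝ≥0 × (ℝ → X) | LipschitzWith p.1 p.2 ∧ p.2 0 = x ∧ p.2 1 = y} := by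
    simp only [lipschitzWith_iff_dist_le_mul, ofPred_and, ofPred_forall]
    refine (isClosed_iInter fun s => isClosed_iInter fun t => ?_).inter
      (IsClosed.inter ?_ ?_)
    · exact isClosed_le (by fun_prop) (by fun_prop)
    · exact isClosed_eq (by fun_prop) continuous_const
    · exact isClosed_eq (by fun_prop) continuous_const
  have h_image : {L | JoinedByLipschitz K x y L} ∩ Iic M = Prod.fst ''
      ((Icc 0 M ×ˢ univ.pi fun _ : ℝ => K) ∩
        {p : ℝ≥0 × (ℝ → X) | LipschitzWith p.1 p.2 ∧ p.2 0 = x ∧ p.2 1 = y}) := by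
    ext L
    constructor
    · rintro ⟨⟨f, hf, hfK, hfxy⟩, hL⟩
      exact ⟨(L, f), ⟨⟨⟨zero_le, hL⟩, fun t _ => hfK t⟩, hf, hfxy⟩, rfl⟩
    · rintro ⟨⟨L, f⟩, ⟨⟨hL, hfK⟩, hf, hfxy⟩, rfl⟩
      exact ⟨⟨f, hf, fun t => hfK t trivial, hfxy⟩, hL.2⟩
  have h_compact : IsCompact ({L | JoinedByLipschitz K x y L} ∩ Iic M) :=
    h_image ▸ ((isCompact_Icc.prod (isCompact_univ_pi fun _ => hK)).inter_right h_closed).image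
      continuous_fst
  obtain ⟨L, ⟨hL, hLM⟩, hmin⟩ := h_compact.exists_isLeast ⟨M, hM, mem_Iic.2 le_rfl⟩
  exact ⟨L, hL, fun L' hL' => (le_total L' M).elim (fun h => hmin ⟨hL', h⟩) hLM.trans⟩

theorem of_lipschitzOnWith [PseudoEMetricSpace X] {K : Set X} {c : ℝ → X} {ℓ : ℝ} (hℓ : 0 ≤ ℓ)
    (hc : LipschitzOnWith 1 c (Icc 0 ℓ)) (hK : MapsTo c (Icc 0 ℓ) K) :
    JoinedByLipschitz K (c 0) (c ℓ) ℓ.toNNReal := by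
  refine ⟨fun t => c (projIcc 0 ℓ hℓ (t * ℓ)), ?_, fun t => hK (projIcc 0 ℓ hℓ _).2,
    by simp, by simp⟩
  have h_scale : LipschitzWith ℓ.toNNReal fun t : ℝ => t * ℓ :=
    LipschitzWith.of_dist_le_mul fun s t => by
      rw [Real.dist_eq, Real.dist_eq, ← sub_mul, abs_mul, abs_of_nonneg hℓ, Real.coe_toNNReal ℓ hℓ,
        mul_comm]
  simpa using! ((lipschitzOnWith_iff_restrict.1 hc).comp (LipschitzWith.projIcc hℓ)).comp h_scale

theorem excise [PseudoEMetricSpace X] {K : Set X} {c : ℝ → X} {ℓ s t : ℝ}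
    (hc : LipschitzOnWith 1 c (Icc 0 ℓ)) (hK : MapsTo c (Icc 0 ℓ) K)
    (hs : 0 ≤ s) (hst : s ≤ t) (ht : t ≤ ℓ) (heq : c s = c t) :
    JoinedByLipschitz K (c 0) (c ℓ) (ℓ - (t - s)).toNNReal := by
  let e : ℝ → X := fun p => if p ≤ s then c p else c (p + (t - s))
  have he_left : EqOn c e (Icc 0 s) := fun p hp => (if_pos hp.2).symm
  have he_right : EqOn (fun p => c (p + (t - s))) e (Icc s (ℓ - (t - s))) := by
    intro p hp
    rcases hp.1.eq_or_lt with rfl | hsp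
    · simp [e, heq]
    · exact (if_neg hsp.not_ge).symm
  have h_shift : MapsTo (fun p => p + (t - s)) (Icc s (ℓ - (t - s))) (Icc 0 ℓ) :=
    fun p hp => ⟨by linarith [hp.1], by linarith [hp.2]⟩
  have h_left : LipschitzOnWith 1 e (Icc 0 s) := fun p hp q hq => by
    rw [← he_left hp, ← he_left hq]
    exact hc ⟨hp.1, by linarith [hp.2]⟩ ⟨hq.1, by linarith [hq.2]⟩
  have h_right : LipschitzOnWith 1 e (Icc s (ℓ - (t - s))) := fun p hp q hq => by
    rw [← he_right hp, ← he_right hq]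
    simpa using hc (h_shift hp) (h_shift hq)
  have h_maps : MapsTo e (Icc 0 (ℓ - (t - s))) K := fun p hp => by
    rcases le_total p s with hps | hsp
    · exact he_left ⟨hp.1, hps⟩ ▸ hK ⟨hp.1, by linarith⟩
    · exact he_right ⟨hsp, hp.2⟩ ▸ hK (h_shift ⟨hsp, hp.2⟩)
  have he_end : e (ℓ - (t - s)) = c ℓ := by
    rw [← he_right ⟨by linarith, le_rfl⟩]
    simp
  have he_zero : e 0 = c 0 := (he_left ⟨le_rfl, hs⟩).symm
  simpa only [he_zero, he_end] using
    of_lipschitzOnWith (by linarith) (lipschitzOnWith_Icc_of_Icc_of_Icc h_left h_right) h_maps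

end JoinedByLipschitz

variable [MetricSpace X]

theorem exists_rectCurve_of_lipschitzWith {f : ℝ → X} {L : ℝ≥0} (hf : LipschitzWith L f)
    (hne : f 0 ≠ f 1) :
    ∃ γ : RectCurve X, γ.toFun = f ∧ γ.a = 0 ∧ γ.b = 1 ∧ γ.length.toReal ≤ L := by
  have h_var : eVariationOn f (Icc 0 1) ≤ L := by
    refine (hf.lipschitzOnWith.comp_eVariationOn_le (f := f) (mapsTo_univ id (Icc 0 1))).trans_eq ?_
    rw [eVariationOn_id_Icc, sub_zero, ENNReal.ofReal_one, mul_one]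
  exact ⟨⟨0, 1, zero_le_one, f, hf.continuous.continuousOn,
    ne_top_of_le_ne_top ENNReal.coe_ne_top h_var, 0, by simp, 1, by simp, hne⟩, rfl, rfl, rfl,
    ENNReal.toReal_mono ENNReal.coe_ne_top h_var⟩

/-- A shortest curve inside the trace is simple: a loop could be cut out of it. -/
theorem RectCurve.exists_isSimple_subcurve (γ : RectCurve X) (hne : γ.toFun γ.a ≠ γ.toFun γ.b) :
    ∃ γ' : RectCurve X, γ'.IsSimple ∧ γ'.trace ⊆ γ.trace ∧ γ'.toFun γ'.a = γ.toFun γ.a ∧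
      γ'.toFun γ'.b = γ.toFun γ.b := by
  have h_joined := JoinedByLipschitz.of_lipschitzOnWith ENNReal.toReal_nonneg
    γ.lipschitzOnWith_arc γ.mapsTo_arc
  rw [γ.arc_zero, γ.arc_length] at h_joined
  obtain ⟨L, ⟨f, hf, hfK, hf0, hf1⟩, hmin⟩ := h_joined.exists_isLeast γ.isCompact_trace
  obtain ⟨γ', rfl, ha, hb, h_length⟩ := exists_rectCurve_of_lipschitzWith hf (by rwa [hf0, hf1])
  rw [← ha] at hf0
  rw [← hb] at hf1
  have h_trace : γ'.trace ⊆ γ.trace := image_subset_iff.2 fun t _ => hfK t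
  refine ⟨γ', ?_, h_trace, hf0, hf1⟩
  intro s hs t ht heq
  wlog hst : s ≤ t generalizing s t
  · exact (this ht hs heq.symm (le_of_not_ge hst)).symm
  have h_short := JoinedByLipschitz.excise γ'.lipschitzOnWith_arc (γ'.mapsTo_arc.mono_right h_trace)
    hs.1 hst ht.2 heq
  rw [γ'.arc_zero, γ'.arc_length, hf0, hf1] at h_short
  have h_le : (L : ℝ) ≤ γ'.length.toReal - (t - s) := by
    have h_min := NNReal.coe_le_coe.2 (hmin h_short)
    rwa [Real.coe_toNNReal _ (by linarith [hs.1, ht.2])] at h_min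
  linarith

end SimpleSubcurve

section HausdorffMeasure

variable {X : Type*} [MetricSpace X] [MeasurableSpace X] [BorelSpace X]

theorem edist_le_hausdorffMeasure_image_Ioc {c : ℝ → X} {s t : ℝ} (hst : s ≤ t)
    (hc : ContinuousOn c (Icc s t)) : edist (c s) (c t) ≤ μH[1] (c '' Ioc s t) := by
  have h_ivt : Ioc 0 (dist (c s) (c t)) ⊆ (dist (c s) ·) '' (c '' Ioc s t) := by
    have h_cont : ContinuousOn (fun r => dist (c s) (c r)) (Icc s t) :=
      (continuous_const.dist continuous_id).comp_continuousOn hc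
    simpa only [dist_self, image_image] using intermediate_value_Ioc hst h_cont
  calc edist (c s) (c t) = μH[1] (Ioc 0 (dist (c s) (c t))) := by
        rw [hausdorffMeasure_real, Real.volume_Ioc, sub_zero, edist_dist]
    _ ≤ μH[1] ((dist (c s) ·) '' (c '' Ioc s t)) := measure_mono h_ivt
    _ ≤ μH[1] (c '' Ioc s t) := by
        simpa using (LipschitzWith.dist_right (c s)).hausdorffMeasure_image_le zero_le_one _

theorem eVariationOn_le_hausdorffMeasure_image {c : ℝ → X} {a b : ℝ}
    (hc : ContinuousOn c (Icc a b)) (hi : InjOn c (Icc a b)) :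
    eVariationOn c (Icc a b) ≤ μH[1] (c '' Icc a b) := by
  refine iSup_le ?_
  rintro ⟨n, u, hu, hu_mem⟩
  have h_Icc (i : ℕ) : Icc (u i) (u (i + 1)) ⊆ Icc a b :=
    Icc_subset_Icc (hu_mem i).1 (hu_mem (i + 1)).2
  have h_Ioc (i : ℕ) : Ioc (u i) (u (i + 1)) ⊆ Icc a b := Ioc_subset_Icc_self.trans (h_Icc i)
  have h_disjoint : Pairwise (Function.onFun Disjoint fun i => c '' Ioc (u i) (u (i + 1))) :=
    fun i j hij => (hu.pairwise_disjoint_on_Ioc_succ hij).image hi (h_Ioc i) (h_Ioc j)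
  calc ∑ i ∈ Finset.range n, edist (c (u (i + 1))) (c (u i))
      ≤ ∑ i ∈ Finset.range n, μH[1] (c '' Ioc (u i) (u (i + 1))) := by
        refine Finset.sum_le_sum fun i _ => ?_
        rw [edist_comm]
        exact edist_le_hausdorffMeasure_image_Ioc (hu (Nat.le_succ i)) (hc.mono (h_Icc i))
    _ = μH[1] (⋃ i ∈ Finset.range n, c '' Ioc (u i) (u (i + 1))) :=
        (measure_biUnion_finset (fun i _ j _ hij => h_disjoint hij) fun i _ =>
          measurableSet_Ioc.image_of_continuousOn_injOn (hc.mono (h_Ioc i))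
            (hi.mono (h_Ioc i))).symm
    _ ≤ μH[1] (c '' Icc a b) := measure_mono (iUnion₂_subset fun i _ => image_mono (h_Ioc i))

namespace RectCurve

variable (γ : RectCurve X)

theorem edist_le_hausdorffMeasure_trace : edist (γ.toFun γ.a) (γ.toFun γ.b) ≤ μH[1] γ.trace :=
  (edist_le_hausdorffMeasure_image_Ioc γ.le γ.continuousOn).trans
    (measure_mono (image_mono Ioc_subset_Icc_self))

omit [MeasurableSpace X] [BorelSpace X] in
theorem edist_le_length : edist (γ.toFun γ.a) (γ.toFun γ.b) ≤ γ.length :=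
  eVariationOn.edist_le _ γ.left_mem γ.right_mem

theorem aemeasurable_arc : AEMeasurable γ.arc (volume.restrict (Icc 0 γ.length.toReal)) :=
  γ.lipschitzOnWith_arc.continuousOn.aemeasurable measurableSet_Icc

theorem hausdorffMeasure_restrict_trace_le :
    μH[1].restrict γ.trace ≤ (volume.restrict (Icc 0 γ.length.toReal)).map γ.arc := by
  refine Measure.le_iff.2 fun A hA => ?_
  rw [Measure.restrict_apply hA, Measure.map_apply_of_aemeasurable γ.aemeasurable_arc hA,
    Measure.restrict_apply' measurableSet_Icc, inter_comm A, inter_comm _ (Icc _ _)]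
  calc μH[1] (γ.trace ∩ A) ≤ μH[1] (γ.arc '' (Icc 0 γ.length.toReal ∩ γ.arc ⁻¹' A)) := by
        rw [image_inter_preimage]
        gcongr
        rintro _ ⟨t, ht, rfl⟩
        exact ⟨_, γ.image_variationOnFromTo ▸ mem_image_of_mem _ ht, γ.arc_variationOnFromTo ht⟩
    _ ≤ volume (Icc 0 γ.length.toReal ∩ γ.arc ⁻¹' A) := by
        simpa [hausdorffMeasure_real] using
          (γ.lipschitzOnWith_arc.mono inter_subset_left).hausdorffMeasure_image_le zero_le_one

namespace IsSimple

variable {γ} (hγ : γ.IsSimple)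
include hγ

theorem length_le_hausdorffMeasure_trace : γ.length ≤ μH[1] γ.trace := by
  have h_var := eVariationOn_le_hausdorffMeasure_image γ.lipschitzOnWith_arc.continuousOn hγ
  rw [γ.eVariationOn_arc le_rfl ENNReal.toReal_nonneg le_rfl, sub_zero,
    γ.ofReal_length] at h_var
  exact h_var.trans (measure_mono γ.mapsTo_arc.image_subset)

theorem map_arc :
    (volume.restrict (Icc 0 γ.length.toReal)).map γ.arc = μH[1].restrict γ.trace := by
  have h_le := γ.hausdorffMeasure_restrict_trace_le
  have : IsFiniteMeasure (μH[1].restrict γ.trace) := isFiniteMeasure_of_le _ h_le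
  refine (Measure.eq_of_le_of_measure_univ_eq h_le (le_antisymm (h_le univ) ?_)).symm
  rw [Measure.map_apply_of_aemeasurable γ.aemeasurable_arc .univ, preimage_univ,
    Measure.restrict_apply_univ, Measure.restrict_apply_univ, Real.volume_Icc, sub_zero,
    γ.ofReal_length]
  exact hγ.length_le_hausdorffMeasure_trace

theorem pathIntegral_eq {ρ : X → ℝ≥0∞} (hρ : Measurable ρ) :
    γ.pathIntegral ρ = ∫⁻ z in γ.trace, ρ z ∂μH[1] := by
  rw [← hγ.map_arc, lintegral_map' hρ.aemeasurable γ.aemeasurable_arc, pathIntegral]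

theorem exists_arc_notMem {A : Set X} (hA : MeasurableSet A) {J N : Set ℝ}
    (hJ : J ⊆ Icc 0 γ.length.toReal) (hN : volume N = 0) (hAJ : μH[1] (γ.trace ∩ A) < volume J) :
    ∃ s ∈ J \ N, γ.arc s ∉ A := by
  by_contra! h_mem
  refine hAJ.not_ge ?_
  calc volume J ≤ volume (Icc 0 γ.length.toReal ∩ γ.arc ⁻¹' A ∪ N) := measure_mono fun s hs =>
        (em (s ∈ N)).symm.imp_left fun hsN => ⟨hJ hs, h_mem s ⟨hs, hsN⟩⟩
    _ ≤ volume (Icc 0 γ.length.toReal ∩ γ.arc ⁻¹' A) := by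
        simpa [hN] using measure_union_le (μ := volume) (Icc 0 γ.length.toReal ∩ γ.arc ⁻¹' A) N
    _ = μH[1] (γ.trace ∩ A) := by
        rw [inter_comm, inter_comm γ.trace, ← Measure.restrict_apply' measurableSet_Icc,
          ← Measure.map_apply_of_aemeasurable γ.aemeasurable_arc hA, hγ.map_arc,
          Measure.restrict_apply hA]

end IsSimple

end RectCurve

end HausdorffMeasure

theorem exists_nat_dyadic_near {δ d : ℝ} (hd : 0 < d) (hdδ : d < δ) :
    ∃ n : ℕ, δ / 2 ^ (n + 1) ≤ d ∧ d < δ / 2 ^ n := by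
  obtain ⟨n, hn_lt, hn_le⟩ := exists_mem_Ioc_zpow (div_pos (hd.trans hdδ) hd) one_lt_two
  have hn : 0 ≤ n := by
    by_contra! hn
    have : (2 : ℝ) ^ (n + 1) ≤ 1 := zpow_le_one_of_nonpos₀ one_le_two (by lia)
    exact ((one_lt_div hd).2 hdδ).not_ge (hn_le.trans this)
  lift n to ℕ using hn
  norm_cast at hn_lt hn_le
  refine ⟨n, (div_le_comm₀ (by positivity) hd).2 ?_, (lt_div_comm₀ hd (by positivity)).2 ?_⟩ <;>
    assumption_mod_cast

section Doubling

variable {X : Type*} [MetricSpace X] [MeasurableSpace X]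

/-- The measure `μ` is positive and finite on balls, and doubling with constant `D`. -/
structure IsDoublingWith (μ : Measure X) (D : ℝ≥0) : Prop where
  pos : ∀ (x : X) {r : ℝ}, 0 < r → μ (ball x r) ≠ 0
  ne_top : ∀ (x : X) (r : ℝ), μ (ball x r) ≠ ∞
  two_mul : ∀ (x : X) {r : ℝ}, 0 < r → μ (ball x (2 * r)) ≤ D * μ (ball x r)

theorem IsDoublingMeasure.exists_isDoublingWith {μ : Measure X} (hμ : IsDoublingMeasure μ) :
    ∃ D, IsDoublingWith μ D := by
  obtain ⟨h_ball, C, -, h_two_mul⟩ := hμ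
  refine ⟨C.toNNReal, fun x r hr => (h_ball x r hr).1.ne', fun x r => ?_, fun x r => h_two_mul x r⟩
  rcases le_or_gt r 0 with hr | hr
  · simp [ball_eq_empty.2 hr]
  · exact (h_ball x r hr).2.ne

/-- One summand of the Riesz kernel, with pole at `x`; it vanishes at the pole itself. -/
noncomputable def rieszPole (μ : Measure X) (x z : X) : ℝ≥0∞ :=
  ENNReal.ofReal (dist x z) / μ (ball x (dist x z))

/-- The set `T` has density zero at `x` with respect to `μ`. -/
def HasDensityZeroAt (μ : Measure X) (T : Set X) (x : X) : Prop :=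
  ∀ η : ℝ≥0∞, 0 < η → ∀ᶠ s in 𝓝[>] (0 : ℝ), μ (T ∩ ball x s) ≤ η * μ (ball x s)

/-- Approximate continuity of `u` at `x` with respect to `μ`. -/
def ApproxContinuousAt (μ : Measure X) (u : X → ℝ) (x : X) : Prop :=
  ∀ ε : ℝ, 0 < ε → HasDensityZeroAt μ {z | ε < |u z - u x|} x

theorem HasDensityZeroAt.mono_ae {μ : Measure X} {S T : Set X} {x : X}
    (hT : HasDensityZeroAt μ T x) (hST : S ≤ᵐ[μ] T) : HasDensityZeroAt μ S x := fun η hη =>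
  (hT η hη).mono fun _ hs => (measure_mono_ae (hST.inter .rfl)).trans hs

namespace IsDoublingWith

variable {μ : Measure X} {D : ℝ≥0} (hμ : IsDoublingWith μ D)
include hμ

theorem measure_ball_two_pow_mul_le (x : X) {r : ℝ} (hr : 0 < r) (n : ℕ) :
    μ (ball x (2 ^ n * r)) ≤ D ^ n * μ (ball x r) := by
  induction n with
  | zero => simp
  | succ n ih =>
    calc μ (ball x (2 ^ (n + 1) * r)) = μ (ball x (2 * (2 ^ n * r))) := by ring_nf
      _ ≤ D * μ (ball x (2 ^ n * r)) := hμ.two_mul x (by positivity)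
      _ ≤ D * (D ^ n * μ (ball x r)) := by gcongr
      _ = D ^ (n + 1) * μ (ball x r) := by ring

theorem measure_ball_le_of_dist_le {x y : X} {r : ℝ} (hr : 0 < r) (hxy : dist x y ≤ r) :
    μ (ball x r) ≤ D * μ (ball y r) :=
  (measure_mono (ball_subset_ball' (by linarith))).trans (hμ.two_mul y hr)

theorem constant_ne_zero (x : X) : D ≠ 0 := by
  rintro rfl
  exact hμ.pos x (r := 2 * 1) (by norm_num) (by simpa using hμ.two_mul x one_pos)

theorem sigmaFinite : SigmaFinite μ := by
  rcases isEmpty_or_nonempty X with hX | ⟨⟨x₀⟩⟩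
  · rw [Measure.eq_zero_of_isEmpty μ]
    infer_instance
  · exact ⟨⟨⟨fun n : ℕ => ball x₀ n, fun _ => trivial, fun n => (hμ.ne_top _ _).lt_top,
      iUnion_ball_nat x₀⟩⟩⟩

theorem isLocallyFiniteMeasure : IsLocallyFiniteMeasure μ :=
  ⟨fun x => ⟨ball x 1, ball_mem_nhds x one_pos, (hμ.ne_top _ _).lt_top⟩⟩

theorem isUnifLocDoublingMeasure : IsUnifLocDoublingMeasure μ := by
  refine ⟨⟨D ^ 2, ?_⟩⟩
  filter_upwards [self_mem_nhdsWithin] with ε (hε : 0 < ε) x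
  calc μ (closedBall x (2 * ε)) ≤ μ (ball x (2 ^ 2 * ε)) :=
        measure_mono (closedBall_subset_ball (by linarith))
    _ ≤ D ^ 2 * μ (ball x ε) := hμ.measure_ball_two_pow_mul_le x hε 2
    _ ≤ (D ^ 2 : ℝ≥0) * μ (closedBall x ε) := by
        push_cast
        gcongr
        exact ball_subset_closedBall

variable [BorelSpace X]

theorem countable_of_pairwiseDisjoint {ι : Type*} {u : Set ι} {c : ι → X} {r : ι → ℝ}
    (hr : ∀ i ∈ u, 0 < r i) (hd : u.PairwiseDisjoint fun i => closedBall (c i) (r i)) :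
    u.Countable := by
  have := hμ.sigmaFinite
  have h_countable := Measure.countable_meas_pos_of_disjoint_iUnion (μ := μ)
    (As := fun i : u => closedBall (c i) (r i)) (fun _ => measurableSet_closedBall)
    fun i j hij => hd i.2 j.2 (Subtype.coe_injective.ne hij)
  have h_pos (i : u) : 0 < μ (closedBall (c i) (r i)) :=
    (pos_iff_ne_zero.2 (hμ.pos _ (hr i i.2))).trans_le (measure_mono ball_subset_closedBall)
  simpa only [h_pos, ofPred_true, countable_univ_iff, countable_coe_iff] using h_countable

theorem secondCountableTopology : SecondCountableTopology X := by
  refine secondCountable_of_almost_dense_set fun ε hε => ?_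
  obtain ⟨u, -, hu_disjoint, hu⟩ :=
    Vitali.exists_disjoint_subfamily_covering_enlargement_closedBall (univ : Set X) id
      (fun _ => ε / 5) (ε / 5) (fun _ _ => le_rfl) 5 (by norm_num)
  refine ⟨u, hμ.countable_of_pairwiseDisjoint (fun _ _ => by positivity) hu_disjoint, fun x => ?_⟩
  obtain ⟨y, hy, hxy⟩ := hu x (mem_univ x)
  exact ⟨y, hy, by simpa [mul_div_cancel₀] using hxy (mem_closedBall_self (by positivity))⟩

theorem measurable_rieszPole : Measurable fun p : X × X => rieszPole μ p.1 p.2 := by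
  have := hμ.sigmaFinite
  have := hμ.secondCountableTopology
  refine measurable_dist.ennreal_ofReal.div ?_
  have h_set : MeasurableSet {q : (X × X) × X | dist q.2 q.1.1 < dist q.1.1 q.1.2} :=
    (isOpen_lt (by fun_prop) (by fun_prop)).measurableSet
  exact measurable_measure_prodMk_left (ν := μ) h_set

theorem measurable_rieszPole_right (x : X) : Measurable (rieszPole μ x) :=
  hμ.measurable_rieszPole.comp measurable_prodMk_left

theorem measurable_rieszKernel (x y : X) : Measurable (rieszKernel μ x y) :=
  (hμ.measurable_rieszPole_right x).add (hμ.measurable_rieszPole_right y)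

omit [BorelSpace X] in
theorem rieszPole_le_mul_rieszPole (x z : X) : rieszPole μ x z ≤ D * rieszPole μ z x := by
  rcases eq_or_ne x z with rfl | hne
  · simp [rieszPole]
  have hd : 0 < dist x z := dist_pos.2 hne
  have h_ball : μ (ball z (dist x z)) ≤ D * μ (ball x (dist x z)) :=
    hμ.measure_ball_le_of_dist_le hd (dist_comm z x).le
  rw [rieszPole, rieszPole, dist_comm z x,
    ENNReal.div_le_iff (hμ.pos x hd) (hμ.ne_top _ _), mul_right_comm, ← mul_div_assoc,
    ENNReal.le_div_iff_mul_le (.inl (hμ.pos z hd)) (.inl (hμ.ne_top _ _)), mul_comm]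
  gcongr

omit [BorelSpace X] hμ in
theorem rieszPole_le_tsum_indicator (x : X) {δ : ℝ} {z : X} (hz : z ∈ ball x δ) :
    rieszPole μ x z ≤ ∑' n : ℕ, (ball x (δ / 2 ^ n)).indicator
      (fun _ => ENNReal.ofReal (δ / 2 ^ n) / μ (ball x (δ / 2 ^ (n + 1)))) z := by
  rcases eq_or_ne x z with rfl | hne
  · simp [rieszPole]
  obtain ⟨n, hn_le, hn_lt⟩ := exists_nat_dyadic_near (dist_pos.2 hne) (mem_ball'.1 hz)
  refine le_trans ?_ (ENNReal.le_tsum n)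
  rw [indicator_of_mem (mem_ball'.2 hn_lt), rieszPole]
  gcongr

omit [BorelSpace X] in
theorem ofReal_div_mul_measure_inter_ball_le (x : X) {r : ℝ} (hr : 0 < r) {A : Set X} {η : ℝ≥0∞}
    (hη : μ (A ∩ ball x (2 * r)) ≤ η * μ (ball x (2 * r))) (a : ℝ) :
    ENNReal.ofReal a / μ (ball x r) * μ (A ∩ ball x (2 * r)) ≤ η * D * ENNReal.ofReal a := by
  calc ENNReal.ofReal a / μ (ball x r) * μ (A ∩ ball x (2 * r))
      ≤ ENNReal.ofReal a / μ (ball x r) * (η * (D * μ (ball x r))) := by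
        grw [hη, hμ.two_mul x hr]
    _ = η * D * (ENNReal.ofReal a / μ (ball x r) * μ (ball x r)) := by ring
    _ = η * D * ENNReal.ofReal a := by
        rw [ENNReal.div_mul_cancel (hμ.pos x hr) (hμ.ne_top _ _)]

/-- Decompose the ball into dyadic annuli around the pole. -/
theorem setLIntegral_rieszPole_le (x : X) {δ : ℝ} (hδ : 0 < δ) {A : Set X} {η : ℝ≥0∞}
    (hη : ∀ s, 0 < s → s ≤ δ → μ (A ∩ ball x s) ≤ η * μ (ball x s)) :
    ∫⁻ z in A ∩ ball x δ, rieszPole μ x z ∂μ ≤ η * D * ENNReal.ofReal (2 * δ) := by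
  have h_annulus (n : ℕ) : ENNReal.ofReal (δ / 2 ^ n) / μ (ball x (δ / 2 ^ (n + 1))) *
      μ (A ∩ ball x (δ / 2 ^ n)) ≤ η * D * ENNReal.ofReal (δ / 2 ^ n) := by
    have h_two_mul : 2 * (δ / 2 ^ (n + 1)) = δ / 2 ^ n := by
      rw [pow_succ']
      field_simp
    have h_le := hμ.ofReal_div_mul_measure_inter_ball_le x (r := δ / 2 ^ (n + 1)) (A := A) (η := η)
      (by positivity)
    rw [h_two_mul] at h_le
    exact h_le (hη _ (by positivity) (div_le_self hδ.le (one_le_pow₀ one_le_two))) _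
  calc ∫⁻ z in A ∩ ball x δ, rieszPole μ x z ∂μ
      ≤ ∫⁻ z in A ∩ ball x δ, ∑' n : ℕ, (ball x (δ / 2 ^ n)).indicator
          (fun _ => ENNReal.ofReal (δ / 2 ^ n) / μ (ball x (δ / 2 ^ (n + 1)))) z ∂μ := by
        refine lintegral_mono_ae (ae_restrict_of_ae_restrict_of_subset inter_subset_right ?_)
        exact ae_restrict_of_forall_mem measurableSet_ball fun z => rieszPole_le_tsum_indicator x
    _ ≤ ∑' n : ℕ, ENNReal.ofReal (δ / 2 ^ n) / μ (ball x (δ / 2 ^ (n + 1))) *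
          μ (A ∩ ball x (δ / 2 ^ n)) := by
        rw [lintegral_tsum fun n => (measurable_const.indicator measurableSet_ball).aemeasurable]
        refine ENNReal.tsum_le_tsum fun n => ?_
        rw [lintegral_indicator_const measurableSet_ball, Measure.restrict_apply measurableSet_ball]
        exact mul_le_mul' le_rfl (measure_mono fun z hz => ⟨hz.2.1, hz.1⟩)
    _ ≤ ∑' n : ℕ, η * D * ENNReal.ofReal (δ / 2 ^ n) := ENNReal.tsum_le_tsum h_annulus
    _ = η * D * ENNReal.ofReal (2 * δ) := by
        have h_geom := hasSum_geometric_two' (2 * δ)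
        simp only [mul_div_cancel_left₀ δ (two_ne_zero' ℝ)] at h_geom
        rw [ENNReal.tsum_mul_left, ← ENNReal.ofReal_tsum_of_nonneg (fun n => by positivity)
          h_geom.summable, h_geom.tsum_eq]

theorem setLIntegral_ball_rieszPole_le (x : X) {δ : ℝ} (hδ : 0 < δ) :
    ∫⁻ z in ball x δ, rieszPole μ x z ∂μ ≤ D * ENNReal.ofReal (2 * δ) := by
  simpa using hμ.setLIntegral_rieszPole_le x hδ (A := univ) (η := 1) (by simp)

theorem setLIntegral_ball_rieszPole_left_le (z : X) {δ : ℝ} (hδ : 0 < δ) :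
    ∫⁻ x in ball z δ, rieszPole μ x z ∂μ ≤ D ^ 2 * ENNReal.ofReal (2 * δ) :=
  calc ∫⁻ x in ball z δ, rieszPole μ x z ∂μ ≤ ∫⁻ x in ball z δ, D * rieszPole μ z x ∂μ :=
        lintegral_mono fun x => hμ.rieszPole_le_mul_rieszPole x z
    _ = D * ∫⁻ x in ball z δ, rieszPole μ z x ∂μ := lintegral_const_mul' _ _ ENNReal.coe_ne_top
    _ ≤ D * (D * ENNReal.ofReal (2 * δ)) := by
        gcongr
        exact hμ.setLIntegral_ball_rieszPole_le z hδ
    _ = D ^ 2 * ENNReal.ofReal (2 * δ) := by ring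

theorem ae_hasDensityZeroAt {T : Set X} (hT : MeasurableSet T) :
    ∀ᵐ x ∂μ, x ∉ T → HasDensityZeroAt μ T x := by
  have := hμ.isUnifLocDoublingMeasure
  have := hμ.secondCountableTopology
  have := hμ.isLocallyFiniteMeasure
  filter_upwards [(IsUnifLocDoublingMeasure.vitaliFamily μ
    1).ae_tendsto_measure_inter_div_of_measurableSet hT] with x hx hxT η hη
  have h_centers : ∀ᶠ s in 𝓝[>] (0 : ℝ), x ∈ closedBall x (1 * s) := by
    filter_upwards [self_mem_nhdsWithin] with s (hs : 0 < s)
    exact mem_closedBall_self (by linarith)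
  have h_lim := hx.comp (IsUnifLocDoublingMeasure.tendsto_closedBall_filterAt μ (fun _ => x)
    (fun s => s) tendsto_id h_centers)
  rw [indicator_of_notMem hxT] at h_lim
  have hηD : 0 < η / D := ENNReal.div_pos hη.ne' ENNReal.coe_ne_top
  filter_upwards [h_lim.eventually (gt_mem_nhds hηD), self_mem_nhdsWithin] with s hs (hs0 : 0 < s)
  have h_closedBall : μ (closedBall x s) ≤ D * μ (ball x s) :=
    (measure_mono (closedBall_subset_ball (by linarith))).trans (hμ.two_mul x hs0)
  have h_ne_zero : μ (closedBall x s) ≠ 0 := fun h =>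
    hμ.pos x hs0 (measure_mono_null ball_subset_closedBall h)
  have h_ne_top : μ (closedBall x s) ≠ ∞ :=
    ne_top_of_le_ne_top (ENNReal.mul_ne_top ENNReal.coe_ne_top (hμ.ne_top _ _)) h_closedBall
  calc μ (T ∩ ball x s) ≤ μ (T ∩ closedBall x s) := by
        gcongr
        exact ball_subset_closedBall
    _ ≤ η / D * μ (closedBall x s) := (ENNReal.div_le_iff h_ne_zero h_ne_top).1 hs.le
    _ ≤ η / D * (D * μ (ball x s)) := by gcongr
    _ = η * μ (ball x s) := by
        rw [← mul_assoc, ENNReal.div_mul_cancel (ENNReal.coe_ne_zero.2 (hμ.constant_ne_zero x))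
          ENNReal.coe_ne_top]

theorem ae_approxContinuousAt {u : X → ℝ} (hu : AEMeasurable u μ) :
    ∀ᵐ x ∂μ, ApproxContinuousAt μ u x := by
  have h_density : ∀ᵐ x ∂μ, ∀ p q : ℚ, x ∉ hu.mk u ⁻¹' (Ioo p q)ᶜ →
      HasDensityZeroAt μ (hu.mk u ⁻¹' (Ioo p q)ᶜ) x := by
    simp only [ae_all_iff]
    exact fun p q => hμ.ae_hasDensityZeroAt (hu.measurable_mk measurableSet_Ioo.compl)
  filter_upwards [h_density, hu.ae_eq_mk] with x hx hux ε hε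
  obtain ⟨p, hp, hpx⟩ := exists_rat_btwn (sub_lt_self (u x) hε)
  obtain ⟨q, hxq, hq⟩ := exists_rat_btwn (lt_add_of_pos_right (u x) hε)
  have hx_mem : x ∉ hu.mk u ⁻¹' (Ioo p q)ᶜ := not_not_intro (hux ▸ ⟨hpx, hxq⟩)
  refine (hx p q hx_mem).mono_ae ?_
  filter_upwards [hu.ae_eq_mk] with z hz (h_lt : ε < |u z - u x|) (h_mem : hu.mk u z ∈ Ioo ↑p ↑q)
  rw [← hz] at h_mem
  exact h_lt.not_ge (abs_le.2 ⟨by linarith [h_mem.1], by linarith [h_mem.2]⟩)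

end IsDoublingWith

end Doubling

section Pencil

variable {X : Type*} [MeasurableSpace X] {Ω : Type*} [MeasurableSpace Ω]

theorem lintegral_lintegral_le_of_forall_measure_le {P : Measure Ω} {κ : Ω → Measure X}
    {ν : Measure X} (hκ : ∀ A, MeasurableSet A → AEMeasurable (κ · A) P ∧ ∫⁻ ω, κ ω A ∂P ≤ ν A)
    {ρ : X → ℝ≥0∞} (hρ : Measurable ρ) :
    AEMeasurable (fun ω => ∫⁻ z, ρ z ∂κ ω) P ∧ ∫⁻ ω, ∫⁻ z, ρ z ∂κ ω ∂P ≤ ∫⁻ z, ρ z ∂ν := by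
  refine Measurable.ennreal_induction (motive := fun ρ =>
    AEMeasurable (fun ω => ∫⁻ z, ρ z ∂κ ω) P ∧ ∫⁻ ω, ∫⁻ z, ρ z ∂κ ω ∂P ≤ ∫⁻ z, ρ z ∂ν)
    (fun c A hA => ?_) (fun f g _ hf _ ihf ihg => ?_) (fun f hf h_mono ih => ?_) hρ
  · simp only [lintegral_indicator_const hA]
    refine ⟨(hκ A hA).1.const_mul c, ?_⟩
    rw [lintegral_const_mul'' _ (hκ A hA).1]
    gcongr
    exact (hκ A hA).2
  · simp only [Pi.add_apply, lintegral_add_left hf]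
    rw [lintegral_add_left' ihf.1]
    exact ⟨ihf.1.add ihg.1, add_le_add ihf.2 ihg.2⟩
  · simp only [lintegral_iSup hf h_mono]
    refine ⟨.iSup fun n => (ih n).1, ?_⟩
    rw [lintegral_iSup' (fun n => (ih n).1)
      (.of_forall fun ω i j hij => lintegral_mono (h_mono hij))]
    gcongr with n
    exact (ih n).2

variable [MetricSpace X] [BorelSpace X]

/-- A random simple curve `c` from `x` to `y`. The curve runs inside a random set `T`, and the
expected length of `T` in a Borel set is at most its `ν`-measure. (The set `T` is kept because the
length of `c` in a Borel set need not be measurable.) -/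
structure IsSimplePencil (ν : Measure X) (x y : X) (P : Measure Ω) (T : Ω → Set X)
    (c : Ω → RectCurve X) : Prop where
  isProbabilityMeasure : IsProbabilityMeasure P
  isSimple : ∀ ω, (c ω).IsSimple
  left : ∀ ω, (c ω).toFun (c ω).a = x
  right : ∀ ω, (c ω).toFun (c ω).b = y
  trace_subset : ∀ ω, (c ω).trace ⊆ T ω
  measure_le : ∀ A, MeasurableSet A → AEMeasurable (fun ω => μH[1].restrict (T ω) A) P ∧
    ∫⁻ ω, μH[1].restrict (T ω) A ∂P ≤ ν A

namespace IsSimplePencil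

variable {ν : Measure X} {x y : X} {P : Measure Ω} {T : Ω → Set X} {c : Ω → RectCurve X}

variable (hc : IsSimplePencil ν x y P T c)
include hc

theorem pathIntegral_le (ω : Ω) {ρ : X → ℝ≥0∞} (hρ : Measurable ρ) :
    (c ω).pathIntegral ρ ≤ ∫⁻ z in T ω, ρ z ∂μH[1] :=
  ((hc.isSimple ω).pathIntegral_eq hρ).trans_le (lintegral_mono_set (hc.trace_subset ω))

theorem ofReal_dist_le_length (ω : Ω) : ENNReal.ofReal (dist x y) ≤ (c ω).length := by
  simpa only [hc.left, hc.right, edist_dist] using (c ω).edist_le_length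

theorem aemeasurable_liminf {ρ : ℕ → X → ℝ≥0∞} (hρ : ∀ i, Measurable (ρ i)) :
    AEMeasurable (fun ω => liminf (fun i => ∫⁻ z in T ω, ρ i z ∂μH[1]) atTop) P := by
  simp only [liminf_eq_iSup_iInf_of_nat']
  exact .iSup fun n => .iInf fun i =>
    (lintegral_lintegral_le_of_forall_measure_le hc.measure_le (hρ (i + n))).1

theorem lintegral_liminf_le {ρ : ℕ → X → ℝ≥0∞} (hρ : ∀ i, Measurable (ρ i)) :
    ∫⁻ ω, liminf (fun i => ∫⁻ z in T ω, ρ i z ∂μH[1]) atTop ∂P ≤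
      liminf (fun i => ∫⁻ z, ρ i z ∂ν) atTop := by
  have h_le (i) := lintegral_lintegral_le_of_forall_measure_le hc.measure_le (hρ i)
  exact (lintegral_liminf_le' fun i => (h_le i).1).trans
    (liminf_le_liminf (.of_forall fun i => (h_le i).2))

theorem measure_setOf_ofReal_le_le {A : Set X} (hA : MeasurableSet A) {δ : ℝ} (hδ : 0 < δ)
    {θ : ℝ≥0∞} (hAθ : ν A ≤ θ * ENNReal.ofReal δ) :
    P {ω | ENNReal.ofReal δ ≤ μH[1].restrict (T ω) A} ≤ θ := by
  have h_chebyshev := (mul_meas_ge_le_lintegral₀ (hc.measure_le A hA).1 (ENNReal.ofReal δ)).trans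
    ((hc.measure_le A hA).2.trans hAθ)
  rw [mul_comm] at h_chebyshev
  exact (ENNReal.mul_le_mul_iff_left (by simpa using hδ) ENNReal.ofReal_ne_top).1 h_chebyshev

theorem ae_notMem_of_AMModulus_eq_zero {Γ₀ : Set (RectCurve X)} (hΓ₀ : AMModulus ν Γ₀ = 0) :
    ∀ᵐ ω ∂P, c ω ∉ Γ₀ := by
  have h_le : P {ω | ¬c ω ∉ Γ₀} ≤ AMModulus ν Γ₀ := by
    refine le_iInf₂ fun ρ ⟨hρ, h_adm⟩ => ?_
    calc P {ω | ¬c ω ∉ Γ₀}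
        ≤ P {ω | 1 ≤ liminf (fun i => ∫⁻ z in T ω, ρ i z ∂μH[1]) atTop} :=
          measure_mono fun ω hω => (h_adm _ (not_not.1 hω)).trans
            (liminf_le_liminf (.of_forall fun i => hc.pathIntegral_le ω (hρ i)))
      _ ≤ ∫⁻ ω, liminf (fun i => ∫⁻ z in T ω, ρ i z ∂μH[1]) atTop ∂P := by
          simpa using mul_meas_ge_le_lintegral₀ (hc.aemeasurable_liminf hρ) 1
      _ ≤ liminf (fun i => ∫⁻ z, ρ i z ∂ν) atTop := hc.lintegral_liminf_le hρ
  exact nonpos_iff_eq_zero.1 (h_le.trans hΓ₀.le)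

theorem ofReal_dist_le_measure {A : Set X} (hA : MeasurableSet A) (hA_null : μH[1] Aᶜ = 0) :
    ENNReal.ofReal (dist x y) ≤ ν A := by
  have := hc.isProbabilityMeasure
  have h_full (ω : Ω) : ENNReal.ofReal (dist x y) ≤ μH[1].restrict (T ω) A :=
    calc ENNReal.ofReal (dist x y) ≤ μH[1] (c ω).trace := by
          simpa only [hc.left, hc.right, edist_dist] using (c ω).edist_le_hausdorffMeasure_trace
      _ ≤ μH[1] (T ω) := measure_mono (hc.trace_subset ω)
      _ ≤ μH[1].restrict (T ω) A := by
          rw [Measure.restrict_apply hA, inter_comm, measure_inter_conull hA_null]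
  calc ENNReal.ofReal (dist x y) = ∫⁻ _, ENNReal.ofReal (dist x y) ∂P := by simp
    _ ≤ ∫⁻ ω, μH[1].restrict (T ω) A ∂P := lintegral_mono h_full
    _ ≤ ν A := (hc.measure_le A hA).2

end IsSimplePencil

/-- The measure on `S` with density the Riesz kernel with poles `x` and `y`. -/
noncomputable def rieszMeasure (μ : Measure X) (S : Set X) (x y : X) : Measure X :=
  (μ.restrict S).withDensity (rieszKernel μ x y)

omit [BorelSpace X] in
theorem rieszMeasure_mono {μ : Measure X} {S S' : Set X} (hS : S ⊆ S') (x y : X) :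
    rieszMeasure μ S x y ≤ rieszMeasure μ S' x y :=
  Measure.le_iff.2 fun A hA => by
    rw [rieszMeasure, rieszMeasure, withDensity_apply _ hA, withDensity_apply _ hA]
    gcongr

omit [BorelSpace X] in
theorem rieszMeasure_comm (μ : Measure X) (S : Set X) (x y : X) :
    rieszMeasure μ S x y = rieszMeasure μ S y x := by
  have h_kernel : rieszKernel μ x y = rieszKernel μ y x := funext fun _ => add_comm _ _
  rw [rieszMeasure, rieszMeasure, h_kernel]

/-- A Semmes pencil of curves with constant `C`, except that nothing is required of the lengths
of the curves. -/
def SupportsUnboundedPencil (μ : Measure X) (C : ℝ) : Prop :=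
  0 < C ∧ ∀ x y : X, x ≠ y →
    ∃ (Γ : Set (RectCurve X)) (_ : MeasurableSpace Γ) (σ : Measure Γ),
      IsProbabilityMeasure σ ∧ (∀ γ ∈ Γ, γ.toFun γ.a = x ∧ γ.toFun γ.b = y) ∧
      ∀ A : Set X, MeasurableSet A → AEMeasurable (fun γ : Γ => μH[1] (γ.1.trace ∩ A)) σ ∧
        ∫⁻ γ : Γ, μH[1] (γ.1.trace ∩ A) ∂σ ≤
          ENNReal.ofReal C * ∫⁻ z in twoBalls C x y ∩ A, rieszKernel μ x y z ∂μ

theorem SupportsSemmesPencil.exists_supportsUnboundedPencil {μ : Measure X}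
    (hX : SupportsSemmesPencil μ) : ∃ C, SupportsUnboundedPencil μ C := by
  obtain ⟨C, hC, h⟩ := hX
  refine ⟨C, hC, fun x y hxy => ?_⟩
  obtain ⟨Γ, mΓ, σ, hσ, h_joins, h_length⟩ := h x y hxy
  exact ⟨Γ, mΓ, σ, hσ, fun γ hγ => ⟨(h_joins γ hγ).1, (h_joins γ hγ).2.1⟩, h_length⟩

namespace SupportsUnboundedPencil

variable {μ : Measure X} {C : ℝ} (hX : SupportsUnboundedPencil μ C) {x y : X}
include hX

theorem exists_isSimplePencil (hxy : x ≠ y) {S : Set X} (hS : twoBalls C x y ⊆ S) :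
    ∃ (Γ : Set (RectCurve X)) (_ : MeasurableSpace Γ) (σ : Measure Γ) (c : Γ → RectCurve X),
      IsSimplePencil (ENNReal.ofReal C • rieszMeasure μ S x y) x y σ (fun γ => γ.1.trace) c := by
  obtain ⟨Γ, mΓ, σ, hσ, h_joins, h_length⟩ := hX.2 x y hxy
  have h_simple (γ : Γ) := γ.1.exists_isSimple_subcurve
    (by rwa [(h_joins γ γ.2).1, (h_joins γ γ.2).2])
  choose c hc_simple hc_trace hc_left hc_right using h_simple
  refine ⟨Γ, mΓ, σ, c, hσ, hc_simple, fun γ => (hc_left γ).trans (h_joins γ γ.2).1,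
    fun γ => (hc_right γ).trans (h_joins γ γ.2).2, hc_trace, fun A hA => ?_⟩
  simp only [Measure.restrict_apply hA, inter_comm A, Measure.smul_apply, smul_eq_mul]
  refine (h_length A hA).imp_right fun h_le => h_le.trans ?_
  gcongr
  rw [inter_comm, ← Measure.restrict_restrict hA, ← withDensity_apply _ hA]
  exact rieszMeasure_mono hS x y A

theorem exists_dist_eq {s : ℝ} (hs : 0 ≤ s) (hsy : s ≤ dist x y) : ∃ p, dist x p = s := by
  rcases eq_or_ne x y with rfl | hxy
  · exact ⟨x, le_antisymm ((dist_self x).trans_le hs) hsy⟩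
  obtain ⟨Γ, _, σ, hc⟩ := hX.exists_isSimplePencil hxy Subset.rfl
  obtain ⟨c, hc⟩ := hc
  have := hc.isProbabilityMeasure
  obtain ⟨γ⟩ := σ.nonempty_of_neZero
  have h_cont : ContinuousOn (fun t => dist x ((c γ).toFun t)) (Icc (c γ).a (c γ).b) :=
    (continuous_const.dist continuous_id).comp_continuousOn (c γ).continuousOn
  obtain ⟨t, -, ht⟩ := intermediate_value_Icc (c γ).le h_cont
    (by simpa only [hc.left, hc.right, dist_self] using ⟨hs, hsy⟩)
  exact ⟨_, ht⟩

theorem twoBalls_subset_ball {x₀ : X} {r d : ℝ} (hx : dist x x₀ ≤ r) (hy : dist y x₀ ≤ r)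
    (hd : dist x y ≤ d) : twoBalls C x y ⊆ ball x₀ (C * d + r) := by
  have h_mul : C * dist x y ≤ C * d := mul_le_mul_of_nonneg_left hd hX.1.le
  exact union_subset (ball_subset_ball' (by linarith)) (ball_subset_ball' (by linarith))

end SupportsUnboundedPencil

end Pencil

theorem ediam_closedBall_le_ofReal {X : Type*} [PseudoMetricSpace X] (x : X) (r : ℝ) :
    ediam (closedBall x r) ≤ ENNReal.ofReal (2 * r) := by
  rw [ENNReal.ofReal_mul zero_le_two, ENNReal.ofReal_ofNat]
  have h_subset : closedBall x r ⊆ closedEBall x (ENNReal.ofReal r) := fun y hy =>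
    mem_closedEBall.2 ((edist_dist y x).trans_le (ENNReal.ofReal_le_ofReal hy))
  exact (ediam_mono h_subset).trans ediam_closedEBall_le

section LowerDensity

variable {X : Type*} [MetricSpace X] [MeasurableSpace X]

/-- The Riesz potential at `x` of `f` on `S`. -/
noncomputable def rieszPotential (μ : Measure X) (S : Set X) (f : X → ℝ≥0∞) (x : X) : ℝ≥0∞ :=
  ∫⁻ z in S, rieszPole μ x z * f z ∂μ

/-- The lower one-dimensional density of `μ` at `x` is finite. -/
def HasFiniteLowerDensityAt (μ : Measure X) (x : X) : Prop :=
  ∃ M : ℝ≥0, ∃ᶠ δ in 𝓝[>] (0 : ℝ), μ (ball x δ) ≤ M * ENNReal.ofReal δ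

variable [BorelSpace X]

namespace IsDoublingWith

variable {μ : Measure X} {D : ℝ≥0} (hμ : IsDoublingWith μ D)
include hμ

theorem lintegral_rieszMeasure {f : X → ℝ≥0∞} (hf : Measurable f) (S : Set X) (x y : X) :
    ∫⁻ z, f z ∂rieszMeasure μ S x y = rieszPotential μ S f x + rieszPotential μ S f y := by
  rw [rieszMeasure, lintegral_withDensity_eq_lintegral_mul _ (hμ.measurable_rieszKernel x y) hf]
  simp only [Pi.mul_apply, rieszKernel, add_mul]
  exact lintegral_add_left ((hμ.measurable_rieszPole_right x).mul hf) _

theorem rieszMeasure_apply {S : Set X} (hS : MeasurableSet S) (x y : X) (A : Set X) :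
    rieszMeasure μ S x y A =
      ∫⁻ z in A ∩ S, rieszPole μ x z ∂μ + ∫⁻ z in A ∩ S, rieszPole μ y z ∂μ := by
  have := hμ.sigmaFinite
  rw [rieszMeasure, ← restrict_withDensity hS, Measure.restrict_apply' hS, withDensity_apply']
  exact lintegral_add_left (hμ.measurable_rieszPole_right x) _

theorem setLIntegral_rieszPotential_le (x₀ : X) {R : ℝ} (hR : 0 < R) {B S : Set X}
    (hB : B ⊆ ball x₀ R) (hS : S ⊆ ball x₀ R) {f : X → ℝ≥0∞} (hf : Measurable f) :
    ∫⁻ x in B, rieszPotential μ S f x ∂μ ≤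
      D ^ 2 * ENNReal.ofReal (4 * R) * ∫⁻ z in S, f z ∂μ := by
  have := hμ.sigmaFinite
  have := hμ.secondCountableTopology
  have h_pole (z : X) (hz : z ∈ ball x₀ R) :
      ∫⁻ x in B, rieszPole μ x z ∂μ ≤ D ^ 2 * ENNReal.ofReal (4 * R) := by
    have hBz : B ⊆ ball z (2 * R) :=
      hB.trans (ball_subset_ball' (by linarith [mem_ball'.1 hz]))
    refine (lintegral_mono_set hBz).trans
      ((hμ.setLIntegral_ball_rieszPole_left_le z (by positivity)).trans_eq ?_)
    ring_nf
  have h_meas : Measurable fun p : X × X => rieszPole μ p.1 p.2 * f p.2 :=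
    hμ.measurable_rieszPole.mul (hf.comp measurable_snd)
  calc ∫⁻ x in B, rieszPotential μ S f x ∂μ
      = ∫⁻ z in S, ∫⁻ x in B, rieszPole μ x z * f z ∂μ ∂μ :=
        lintegral_lintegral_swap h_meas.aemeasurable
    _ ≤ ∫⁻ z in S, D ^ 2 * ENNReal.ofReal (4 * R) * f z ∂μ := by
        refine lintegral_mono_ae (ae_restrict_of_ae_restrict_of_subset hS
          (ae_restrict_of_forall_mem measurableSet_ball fun z hz => ?_))
        have h_meas_left : Measurable fun x => rieszPole μ x z :=
          hμ.measurable_rieszPole.comp measurable_prodMk_right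
        rw [lintegral_mul_const _ h_meas_left]
        gcongr
        exact h_pole z hz
    _ = D ^ 2 * ENNReal.ofReal (4 * R) * ∫⁻ z in S, f z ∂μ := lintegral_const_mul _ hf

omit hμ in
theorem tsum_ediam_closedBall_le {M : ℝ≥0} {u : Set X} (hu : u.Countable) {r : X → ℝ}
    (hM : ∀ x ∈ u, M * ENNReal.ofReal (r x) ≤ μ (ball x (r x)))
    (hd : u.PairwiseDisjoint fun x => closedBall x (r x)) {V : Set X}
    (hV : ∀ x ∈ u, ball x (r x) ⊆ V) :
    M * ∑' x : u, ediam (closedBall x.1 (5 * r x)) ≤ 10 * μ V := by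
  have : Countable u := hu.to_subtype
  have h_ediam (x : u) : M * ediam (closedBall x.1 (5 * r x)) ≤ 10 * μ (ball x.1 (r x)) :=
    calc M * ediam (closedBall x.1 (5 * r x)) ≤ M * ENNReal.ofReal (2 * (5 * r x)) := by
          gcongr
          exact ediam_closedBall_le_ofReal x.1 (5 * r x)
      _ = 10 * (M * ENNReal.ofReal (r x)) := by
          rw [← mul_assoc 2 5 (r x), ENNReal.ofReal_mul (by norm_num)]
          norm_num
          ring
      _ ≤ 10 * μ (ball x.1 (r x)) := by
          gcongr
          exact hM x x.2
  have h_disjoint : Pairwise (Function.onFun Disjoint fun x : u => ball x.1 (r x)) :=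
    fun x y hxy => (hd x.2 y.2 (Subtype.coe_injective.ne hxy)).mono
      ball_subset_closedBall ball_subset_closedBall
  calc M * ∑' x : u, ediam (closedBall x.1 (5 * r x))
      ≤ ∑' x : u, 10 * μ (ball x.1 (r x)) := by
        rw [← ENNReal.tsum_mul_left]
        exact ENNReal.tsum_le_tsum h_ediam
    _ = 10 * μ (⋃ x : u, ball x.1 (r x)) := by
        rw [ENNReal.tsum_mul_left, measure_iUnion h_disjoint fun _ => measurableSet_ball]
    _ ≤ 10 * μ V := by
        gcongr
        exact iUnion_subset fun x => hV x x.2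

/-- A disjoint subfamily of the balls, enlarged five times, still covers `E`. -/
theorem exists_covering_tsum_ediam_le (x₀ : X) {R ε : ℝ} (hε : 0 < ε) (hε1 : ε ≤ 1) {M : ℝ≥0}
    {E : Set X} (hE : E ⊆ ball x₀ R)
    (hM : ∀ x ∈ E, ∃ᶠ δ in 𝓝[>] (0 : ℝ), M * ENNReal.ofReal δ ≤ μ (ball x δ)) :
    ∃ (u : Set X) (r : X → ℝ), u.Countable ∧ (∀ x ∈ u, r x ≤ ε) ∧
      E ⊆ ⋃ x : u, closedBall x.1 (5 * r x) ∧
      M * ∑' x : u, ediam (closedBall x.1 (5 * r x)) ≤ 10 * μ (ball x₀ (R + 1)) := by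
  have h_radius (x : X) (hx : x ∈ E) :
      ∃ δ ∈ Ioc 0 ε, M * ENNReal.ofReal δ ≤ μ (ball x δ) := by
    obtain ⟨δ, hδM, hδ⟩ := ((hM x hx).and_eventually (Ioc_mem_nhdsGT hε)).exists
    exact ⟨δ, hδ, hδM⟩
  choose! r hr hrM using h_radius
  obtain ⟨u, huE, hu_disjoint, hu⟩ :=
    Vitali.exists_disjoint_subfamily_covering_enlargement_closedBall E id r ε
      (fun x hx => (hr x hx).2) 5 (by norm_num)
  have hu_countable : u.Countable :=
    hμ.countable_of_pairwiseDisjoint (fun x hx => (hr x (huE hx)).1) hu_disjoint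
  refine ⟨u, r, hu_countable, fun x hx => (hr x (huE hx)).2, fun x hx => ?_, ?_⟩
  · obtain ⟨y, hy, hxy⟩ := hu x hx
    exact mem_iUnion.2 ⟨⟨y, hy⟩, hxy (mem_closedBall_self (hr x hx).1.le)⟩
  refine tsum_ediam_closedBall_le hu_countable (fun x hx => hrM x (huE hx)) hu_disjoint
    fun x hx => ball_subset_ball' ?_
  linarith [mem_ball.1 (hE (huE hx)), (hr x (huE hx)).2]

theorem mul_hausdorffMeasure_le (x₀ : X) {R : ℝ} {M : ℝ≥0} {E : Set X} (hE : E ⊆ ball x₀ R)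
    (hM : ∀ x ∈ E, ∃ᶠ δ in 𝓝[>] (0 : ℝ), M * ENNReal.ofReal δ ≤ μ (ball x δ)) :
    M * μH[1] E ≤ 10 * μ (ball x₀ (R + 1)) := by
  have h_cover (k : ℕ) := hμ.exists_covering_tsum_ediam_le x₀ (ε := 1 / (k + 1))
    Nat.one_div_pos_of_nat (div_le_self zero_le_one (by linarith [k.cast_nonneg (α := ℝ)])) hE hM
  choose u r hu_countable hr hu h_sum using h_cover
  have (k : ℕ) : Countable (u k) := (hu_countable k).to_subtype
  have h_ediam (k : ℕ) (x : u k) : ediam (closedBall x.1 (5 * r k x)) ≤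
      ENNReal.ofReal (10 * (1 / (k + 1))) := by
    refine (ediam_closedBall_le_ofReal x.1 _).trans (ENNReal.ofReal_le_ofReal ?_)
    linarith [hr k x x.2]
  have h_tendsto : Tendsto (fun k : ℕ => ENNReal.ofReal (10 * (1 / (k + 1)))) atTop (𝓝 0) := by
    simpa using ENNReal.tendsto_ofReal (tendsto_one_div_add_atTop_nhds_zero_nat.const_mul (10 : ℝ))
  have h_le := Measure.hausdorffMeasure_le_liminf_tsum 1 E _ h_tendsto
    (fun k (x : u k) => closedBall x.1 (5 * r k x)) (.of_forall h_ediam) (.of_forall hu)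
  simp only [ENNReal.rpow_one] at h_le
  calc M * μH[1] E
      ≤ liminf (fun k => M * ∑' x : u k, ediam (closedBall x.1 (5 * r k x))) atTop := by
        rw [ENNReal.liminf_const_mul_of_ne_top ENNReal.coe_ne_top]
        gcongr
    _ ≤ 10 * μ (ball x₀ (R + 1)) :=
        liminf_le_of_frequently_le' (.of_forall h_sum)

theorem hausdorffMeasure_setOf_not_hasFiniteLowerDensityAt :
    μH[1] {x | ¬HasFiniteLowerDensityAt μ x} = 0 := by
  rcases isEmpty_or_nonempty X with hX | ⟨⟨x₀⟩⟩
  · simp [Set.eq_empty_of_isEmpty]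
  rw [← inter_univ {x | _}, ← iUnion_ball_nat x₀, inter_iUnion]
  refine measure_iUnion_null fun n => ?_
  have h_le (M : ℝ≥0) : M * μH[1] ({x | ¬HasFiniteLowerDensityAt μ x} ∩ ball x₀ n) ≤
      10 * μ (ball x₀ (n + 1)) := by
    refine hμ.mul_hausdorffMeasure_le x₀ inter_subset_right fun x hx => ?_
    simp only [HasFiniteLowerDensityAt, not_exists, not_frequently, not_le] at hx
    exact ((hx.1 M).mono fun _ h_lt => h_lt.le).frequently
  by_contra h_ne
  obtain ⟨M, hM⟩ := ENNReal.exists_nat_mul_gt h_ne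
    (ENNReal.mul_ne_top (ENNReal.ofNat_ne_top (n := 10)) (hμ.ne_top x₀ (n + 1)))
  exact (h_le M).not_gt hM

variable {C : ℝ} (hX : SupportsUnboundedPencil μ C)
include hX

theorem ofReal_mul_measure_ball_le_setLIntegral_dist {x y : X} {r : ℝ} (hr : 0 < r)
    (hxy : r ≤ dist x y) : ENNReal.ofReal r * μ (ball x r) ≤
      4 * D ^ 3 * ∫⁻ z in ball x r, ENNReal.ofReal (dist x z) ∂μ := by
  obtain ⟨p, hp⟩ := hX.exists_dist_eq (x := x) (y := y) (half_pos hr).le (by linarith)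
  have h_ball : μ (ball x r) ≤ D ^ 3 * μ (ball p (r / 4)) :=
    (measure_mono (ball_subset_ball' (by linarith))).trans
      (hμ.measure_ball_two_pow_mul_le p (by positivity) 3)
  have h_integral : ENNReal.ofReal (r / 4) * μ (ball p (r / 4)) ≤
      ∫⁻ z in ball x r, ENNReal.ofReal (dist x z) ∂μ := by
    rw [← setLIntegral_const]
    refine (setLIntegral_mono' measurableSet_ball fun z hz => ENNReal.ofReal_le_ofReal ?_).trans
      (lintegral_mono_set (ball_subset_ball' (by linarith [dist_comm p x])))
    linarith [mem_ball.1 hz, dist_triangle x z p]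
  calc ENNReal.ofReal r * μ (ball x r) ≤ ENNReal.ofReal (4 * (r / 4)) *
        (D ^ 3 * μ (ball p (r / 4))) := by
        rw [mul_div_cancel₀ r four_ne_zero]
        gcongr
    _ = 4 * D ^ 3 * (ENNReal.ofReal (r / 4) * μ (ball p (r / 4))) := by
        rw [ENNReal.ofReal_mul zero_le_four, ENNReal.ofReal_ofNat]
        ring
    _ ≤ 4 * D ^ 3 * ∫⁻ z in ball x r, ENNReal.ofReal (dist x z) ∂μ := by gcongr

theorem ofReal_dist_le_of_hausdorffMeasure_compl_eq_zero {A : Set X} (hA : MeasurableSet A)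
    (hA_null : μH[1] Aᶜ = 0) {x z : X} {r : ℝ} (hz : z ∈ ball x r) :
    ENNReal.ofReal (dist x z) ≤ ENNReal.ofReal C *
      (rieszPotential μ (A ∩ ball x ((C + 1) * r)) 1 x +
        rieszPotential μ (A ∩ ball x ((C + 1) * r)) 1 z) := by
  rcases eq_or_ne x z with rfl | hxz
  · simp
  have h_twoBalls : twoBalls C x z ⊆ ball x ((C + 1) * r) :=
    (hX.twoBalls_subset_ball (by simpa using (pos_of_mem_ball hz).le) (mem_ball.1 hz).le
      (mem_ball'.1 hz).le).trans_eq (by ring_nf)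
  obtain ⟨Γ, _, σ, c, hc⟩ := hX.exists_isSimplePencil hxz h_twoBalls
  simpa [hμ.rieszMeasure_apply measurableSet_ball, rieszPotential]
    using hc.ofReal_dist_le_measure hA hA_null

theorem setLIntegral_dist_le_of_hausdorffMeasure_compl_eq_zero {A : Set X} (hA : MeasurableSet A)
    (hA_null : μH[1] Aᶜ = 0) {x : X} {r : ℝ} (hr : 0 < r) {k : ℕ} (hk : C + 1 ≤ 2 ^ k)
    {η : ℝ≥0∞} (hη : ∀ s, 0 < s → s ≤ (C + 1) * r → μ (A ∩ ball x s) ≤ η * μ (ball x s)) :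
    ∫⁻ z in ball x r, ENNReal.ofReal (dist x z) ∂μ ≤
      ENNReal.ofReal C * ENNReal.ofReal (C + 1) * (2 * D + 4 * D ^ (k + 2)) * η *
        (ENNReal.ofReal r * μ (ball x r)) := by
  have hC := hX.1
  set S := A ∩ ball x ((C + 1) * r)
  have h_pole : rieszPotential μ S 1 x ≤ η * D * ENNReal.ofReal (2 * ((C + 1) * r)) := by
    simpa [rieszPotential] using hμ.setLIntegral_rieszPole_le x (by positivity) hη
  have h_measure : μ S ≤ η * (D ^ k * μ (ball x r)) := by
    refine (hη _ (by positivity) le_rfl).trans ?_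
    gcongr
    refine (measure_mono (ball_subset_ball ?_)).trans (hμ.measure_ball_two_pow_mul_le x hr k)
    gcongr
  have h_potential : ∫⁻ z in ball x r, rieszPotential μ S 1 z ∂μ ≤
      D ^ 2 * ENNReal.ofReal (4 * ((C + 1) * r)) * (η * (D ^ k * μ (ball x r))) := by
    refine (hμ.setLIntegral_rieszPotential_le x (by positivity)
      (ball_subset_ball (by nlinarith)) inter_subset_right measurable_one).trans ?_
    simp only [Pi.one_apply, setLIntegral_one]
    gcongr
  calc ∫⁻ z in ball x r, ENNReal.ofReal (dist x z) ∂μ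
      ≤ ∫⁻ z in ball x r, ENNReal.ofReal C *
          (rieszPotential μ S 1 x + rieszPotential μ S 1 z) ∂μ :=
        setLIntegral_mono' measurableSet_ball fun z hz =>
          hμ.ofReal_dist_le_of_hausdorffMeasure_compl_eq_zero hX hA hA_null hz
    _ = ENNReal.ofReal C * (rieszPotential μ S 1 x * μ (ball x r) +
          ∫⁻ z in ball x r, rieszPotential μ S 1 z ∂μ) := by
        rw [lintegral_const_mul' _ _ ENNReal.ofReal_ne_top, lintegral_add_left measurable_const,
          setLIntegral_const]
    _ ≤ ENNReal.ofReal C * (η * D * ENNReal.ofReal (2 * ((C + 1) * r)) * μ (ball x r) +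
          D ^ 2 * ENNReal.ofReal (4 * ((C + 1) * r)) * (η * (D ^ k * μ (ball x r)))) := by
        gcongr
    _ = _ := by
        simp only [ENNReal.ofReal_mul zero_le_two, ENNReal.ofReal_mul zero_le_four,
          ENNReal.ofReal_mul (by positivity : 0 ≤ C + 1), ENNReal.ofReal_ofNat]
        ring

/-- Almost every curve of a pencil avoids an `μH[1]`-null set `N`. At a point of density of `N`
the pencil inequality for `Nᶜ` then bounds distances by a small multiple of the radius. -/
theorem absolutelyContinuous_hausdorffMeasure [Nontrivial X] : μ ≪ μH[1] := by
  refine .mk fun N hN hN_null => measure_eq_zero_iff_ae_notMem.2 ?_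
  obtain ⟨k, hk⟩ := pow_unbounded_of_one_lt (C + 1) one_lt_two
  filter_upwards [hμ.ae_hasDensityZeroAt hN.compl] with x hx hxN
  obtain ⟨y, hy⟩ := exists_ne x
  set Q : ℝ≥0∞ := 4 * D ^ 3 *
    (ENNReal.ofReal C * ENNReal.ofReal (C + 1) * (2 * D + 4 * D ^ (k + 2)))
  have hQ_top : Q ≠ ∞ := by finiteness
  obtain ⟨η, hη, hηQ⟩ := ENNReal.exists_nnreal_pos_mul_lt hQ_top one_ne_zero
  obtain ⟨δ, hδ, h_small⟩ := mem_nhdsGT_iff_exists_Ioc_subset.1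
    (hx (not_not_intro hxN) η (by exact_mod_cast hη))
  have hC : 0 < C + 1 := by linarith [hX.1]
  set r := min (dist x y) (δ / (C + 1))
  have hr : 0 < r := lt_min (dist_pos.2 hy.symm) (div_pos hδ hC)
  have h_density (s : ℝ) (hs : 0 < s) (hsr : s ≤ (C + 1) * r) :
      μ (Nᶜ ∩ ball x s) ≤ η * μ (ball x s) :=
    h_small ⟨hs, hsr.trans ((le_div_iff₀' hC).1 (min_le_right _ _))⟩
  have h_mass : ENNReal.ofReal r * μ (ball x r) ≠ 0 :=
    mul_ne_zero (ENNReal.ofReal_pos.2 hr).ne' (hμ.pos x hr)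
  have h_mass_top : ENNReal.ofReal r * μ (ball x r) ≠ ∞ :=
    ENNReal.mul_ne_top ENNReal.ofReal_ne_top (hμ.ne_top x r)
  refine lt_irrefl (ENNReal.ofReal r * μ (ball x r)) ?_
  calc ENNReal.ofReal r * μ (ball x r)
      ≤ 4 * D ^ 3 * ∫⁻ z in ball x r, ENNReal.ofReal (dist x z) ∂μ :=
        hμ.ofReal_mul_measure_ball_le_setLIntegral_dist hX hr (min_le_left _ _)
    _ ≤ η * Q * (ENNReal.ofReal r * μ (ball x r)) := by
        grw [hμ.setLIntegral_dist_le_of_hausdorffMeasure_compl_eq_zero hX hN.compl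
          (by rwa [compl_compl]) hr hk.le h_density]
        exact le_of_eq (by ring)
    _ < 1 * (ENNReal.ofReal r * μ (ball x r)) := by gcongr
    _ = ENNReal.ofReal r * μ (ball x r) := one_mul _

theorem ae_hasFiniteLowerDensityAt [Nontrivial X] : ∀ᵐ x ∂μ, HasFiniteLowerDensityAt μ x :=
  hμ.absolutelyContinuous_hausdorffMeasure hX
    hμ.hausdorffMeasure_setOf_not_hasFiniteLowerDensityAt

end IsDoublingWith

end LowerDensity

section PointwiseEstimate

theorem le_two_mul_lintegral_of_measure_le {Ω : Type*} [MeasurableSpace Ω] {P : Measure Ω}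
    [IsProbabilityMeasure P] {Φ : Ω → ℝ≥0∞} (hΦ : AEMeasurable Φ P) {v : ℝ≥0∞}
    (hv : P {ω | v ≤ Φ ω}ᶜ ≤ 2⁻¹) : v ≤ 2 * ∫⁻ ω, Φ ω ∂P := by
  have h_half : 2⁻¹ ≤ P {ω | v ≤ Φ ω} := by
    have h_le := (measure_univ_le_add_compl (μ := P) {ω | v ≤ Φ ω}).trans
      (add_le_add_right hv (P {ω | v ≤ Φ ω}))
    rw [measure_univ, ← ENNReal.inv_two_add_inv_two] at h_le
    exact (ENNReal.add_le_add_iff_right (by simp)).1 h_le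
  calc v = 2 * (v * 2⁻¹) := by
        rw [mul_left_comm, ENNReal.mul_inv_cancel two_ne_zero ENNReal.ofNat_ne_top, mul_one]
    _ ≤ 2 * (v * P {ω | v ≤ Φ ω}) := by gcongr
    _ ≤ 2 * ∫⁻ ω, Φ ω ∂P := by
        gcongr
        exact mul_meas_ge_le_lintegral₀ hΦ v

variable {X : Type*} [MetricSpace X]

/-- The sequence `g` controls the oscillation of `u` along `γ` in the sense of the definition of
`BV_AM`-upper bounds. -/
def IsUpperBoundAlong (u : X → ℝ) (g : ℕ → X → ℝ≥0∞) (γ : RectCurve X) : Prop :=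
  ∃ N : Set ℝ, volume N = 0 ∧
    ∀ s ∈ Icc 0 γ.length.toReal \ N, ∀ t ∈ Icc 0 γ.length.toReal \ N, s < t →
      ENNReal.ofReal |u (γ.arc t) - u (γ.arc s)| ≤
        liminf (fun i => γ.subpathIntegral s t (g i)) atTop

variable [MeasurableSpace X]

/-- At the scale of lengths, the set `T` has lower `ν`-density zero at `x`. -/
def HasLinearLowerDensityZeroAt (ν : Measure X) (T : Set X) (x : X) : Prop :=
  ∀ θ : ℝ≥0∞, 0 < θ → ∃ᶠ δ in 𝓝[>] (0 : ℝ), ν (T ∩ ball x δ) ≤ θ * ENNReal.ofReal δ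

theorem HasLinearLowerDensityZeroAt.const_smul {ν : Measure X} {T : Set X} {x : X}
    (hT : HasLinearLowerDensityZeroAt ν T x) {K : ℝ≥0∞} (hK : K ≠ ∞) :
    HasLinearLowerDensityZeroAt (K • ν) T x := by
  intro θ hθ
  obtain ⟨θ', hθ', hθK⟩ := ENNReal.exists_nnreal_pos_mul_lt hK hθ.ne'
  refine (hT θ' (by exact_mod_cast hθ')).mono fun δ hδ => ?_
  calc (K • ν) (T ∩ ball x δ) ≤ K * (θ' * ENNReal.ofReal δ) := by
        rw [Measure.smul_apply, smul_eq_mul]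
        gcongr
    _ = θ' * K * ENNReal.ofReal δ := by ring
    _ ≤ θ * ENNReal.ofReal δ := by gcongr

variable [BorelSpace X]

namespace RectCurve.IsSimple

variable {γ : RectCurve X} (hγ : γ.IsSimple)
include hγ

theorem exists_arc_notMem_of_inter_ball_subset {T A : Set X} (hA : MeasurableSet A) {p δ : ℝ}
    (hp : p ∈ Icc 0 γ.length.toReal) (hTA : T ∩ ball (γ.arc p) δ ⊆ A) {J N : Set ℝ}
    (hJ : J ⊆ Icc 0 γ.length.toReal) (hJp : J ⊆ ball p δ) (hN : volume N = 0)
    (hAJ : μH[1] (γ.trace ∩ A) < volume J) : ∃ s ∈ J \ N, γ.arc s ∉ T := by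
  obtain ⟨s, hs, hsA⟩ := hγ.exists_arc_notMem hA hJ hN hAJ
  have h_dist : dist (γ.arc s) (γ.arc p) ≤ dist s p := by
    simpa using γ.lipschitzOnWith_arc.dist_le_mul s (hJ hs.1) p hp
  exact ⟨s, hs, fun hsT => hsA (hTA ⟨hsT, h_dist.trans_lt (hJp hs.1)⟩)⟩

theorem ofReal_abs_sub_sub_le_liminf {u : X → ℝ} {g : ℕ → X → ℝ≥0∞}
    (hu : IsUpperBoundAlong u g γ) {x y : X} (hx : γ.toFun γ.a = x) (hy : γ.toFun γ.b = y)
    {ε δ₁ δ₂ : ℝ} (hδ₁ : 0 ≤ δ₁) (hδ₂ : 0 ≤ δ₂) (hδ : δ₁ + δ₂ ≤ γ.length.toReal) {A₁ A₂ : Set X}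
    (hA₁ : MeasurableSet A₁) (hA₂ : MeasurableSet A₂)
    (hxA₁ : {z | ε < |u z - u x|} ∩ ball x δ₁ ⊆ A₁)
    (hyA₂ : {z | ε < |u z - u y|} ∩ ball y δ₂ ⊆ A₂)
    (h_small₁ : μH[1] (γ.trace ∩ A₁) < ENNReal.ofReal δ₁)
    (h_small₂ : μH[1] (γ.trace ∩ A₂) < ENNReal.ofReal δ₂) :
    ENNReal.ofReal (|u x - u y| - 2 * ε) ≤ liminf (fun i => γ.pathIntegral (g i)) atTop := by
  obtain ⟨N, hN, h_le⟩ := hu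
  have hℓ : 0 ≤ γ.length.toReal := ENNReal.toReal_nonneg
  obtain ⟨s, ⟨hs, hsN⟩, hsx⟩ := hγ.exists_arc_notMem_of_inter_ball_subset hA₁
    (left_mem_Icc.2 hℓ) (by rwa [γ.arc_zero, hx]) (J := Ico 0 δ₁)
    (fun s hs => ⟨hs.1, by linarith [hs.2]⟩)
    (fun s hs => by simpa [abs_of_nonneg hs.1] using hs.2) hN (by simpa using h_small₁)
  obtain ⟨t, ⟨ht, htN⟩, hty⟩ := hγ.exists_arc_notMem_of_inter_ball_subset hA₂
    (right_mem_Icc.2 hℓ) (by rwa [γ.arc_length, hy]) (J := Ioc (γ.length.toReal - δ₂) _)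
    (fun t ht => ⟨by linarith [ht.1], ht.2⟩)
    (fun t ht => by rw [Real.ball_eq_Ioo]; constructor <;> linarith [ht.1, ht.2])
    hN (by simpa using h_small₂)
  simp only [mem_ofPred_eq, not_lt] at hsx hty
  rw [abs_sub_comm] at hsx
  have h_triangle : |u x - u y| - 2 * ε ≤ |u (γ.arc t) - u (γ.arc s)| := by
    rw [abs_sub_comm (u (γ.arc t))]
    linarith [abs_sub_le (u x) (u (γ.arc s)) (u y),
      abs_sub_le (u (γ.arc s)) (u (γ.arc t)) (u y)]
  calc ENNReal.ofReal (|u x - u y| - 2 * ε)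
      ≤ ENNReal.ofReal |u (γ.arc t) - u (γ.arc s)| := ENNReal.ofReal_le_ofReal h_triangle
    _ ≤ liminf (fun i => γ.subpathIntegral s t (g i)) atTop :=
        h_le s ⟨⟨hs.1, by linarith [hs.2]⟩, hsN⟩ t ⟨⟨by linarith [ht.1], ht.2⟩, htN⟩
          (by linarith [hs.2, ht.1])
    _ ≤ liminf (fun i => γ.pathIntegral (g i)) atTop :=
        liminf_le_liminf (.of_forall fun i => lintegral_mono_set (Icc_subset_Icc hs.1 ht.2))

end RectCurve.IsSimple

namespace IsSimplePencil

variable {Ω : Type*} [MeasurableSpace Ω] {ν : Measure X} {x y : X} {P : Measure Ω}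
  {T : Ω → Set X} {c : Ω → RectCurve X} (hc : IsSimplePencil ν x y P T c)
include hc

theorem hausdorffMeasure_trace_inter_le (ω : Ω) {A : Set X} (hA : MeasurableSet A) :
    μH[1] ((c ω).trace ∩ A) ≤ μH[1].restrict (T ω) A := by
  rw [Measure.restrict_apply hA, inter_comm]
  gcongr
  exact hc.trace_subset ω

theorem ofReal_abs_sub_sub_le_liminf {u : X → ℝ} {g : ℕ → X → ℝ≥0∞} (hg : ∀ i, Measurable (g i))
    {ω : Ω} (hu : IsUpperBoundAlong u g (c ω)) {ε δ₁ δ₂ : ℝ} (hδ₁ : 0 ≤ δ₁) (hδ₂ : 0 ≤ δ₂)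
    (hδ : δ₁ + δ₂ ≤ dist x y) {A₁ A₂ : Set X} (hA₁ : MeasurableSet A₁) (hA₂ : MeasurableSet A₂)
    (hxA₁ : {z | ε < |u z - u x|} ∩ ball x δ₁ ⊆ A₁)
    (hyA₂ : {z | ε < |u z - u y|} ∩ ball y δ₂ ⊆ A₂)
    (h_small₁ : μH[1].restrict (T ω) A₁ < ENNReal.ofReal δ₁)
    (h_small₂ : μH[1].restrict (T ω) A₂ < ENNReal.ofReal δ₂) :
    ENNReal.ofReal (|u x - u y| - 2 * ε) ≤
      liminf (fun i => ∫⁻ z in T ω, g i z ∂μH[1]) atTop := by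
  have h_length : δ₁ + δ₂ ≤ (c ω).length.toReal :=
    hδ.trans ((ENNReal.ofReal_le_iff_le_toReal (c ω).rectifiable).1 (hc.ofReal_dist_le_length ω))
  calc ENNReal.ofReal (|u x - u y| - 2 * ε)
      ≤ liminf (fun i => (c ω).pathIntegral (g i)) atTop :=
        (hc.isSimple ω).ofReal_abs_sub_sub_le_liminf hu (hc.left ω) (hc.right ω) hδ₁ hδ₂
          h_length hA₁ hA₂ hxA₁ hyA₂ ((hc.hausdorffMeasure_trace_inter_le ω hA₁).trans_lt h_small₁)
          ((hc.hausdorffMeasure_trace_inter_le ω hA₂).trans_lt h_small₂)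
    _ ≤ liminf (fun i => ∫⁻ z in T ω, g i z ∂μH[1]) atTop :=
        liminf_le_liminf (.of_forall fun i => hc.pathIntegral_le ω (hg i))

/-- Most curves of the pencil leave the exceptional sets of `x` and of `y` close to the ends. -/
theorem ofReal_abs_sub_sub_le_two_mul_liminf {u : X → ℝ} {g : ℕ → X → ℝ≥0∞}
    (hg : ∀ i, Measurable (g i)) (hu : ∀ᵐ ω ∂P, IsUpperBoundAlong u g (c ω)) (hxy : x ≠ y) {ε : ℝ}
    (hx : HasLinearLowerDensityZeroAt ν {z | ε < |u z - u x|} x)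
    (hy : HasLinearLowerDensityZeroAt ν {z | ε < |u z - u y|} y) :
    ENNReal.ofReal (|u x - u y| - 2 * ε) ≤ 2 * liminf (fun i => ∫⁻ z, g i z ∂ν) atTop := by
  have := hc.isProbabilityMeasure
  have h_quarter : (0 : ℝ≥0∞) < 4⁻¹ := by simp
  have h_near : ∀ᶠ δ in 𝓝[>] (0 : ℝ), δ ∈ Ioo 0 (dist x y / 2) :=
    Ioo_mem_nhdsGT (half_pos (dist_pos.2 hxy))
  obtain ⟨δ₁, h_le₁, hδ₁, hδ₁d⟩ := ((hx 4⁻¹ h_quarter).and_eventually h_near).exists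
  obtain ⟨δ₂, h_le₂, hδ₂, hδ₂d⟩ := ((hy 4⁻¹ h_quarter).and_eventually h_near).exists
  set A₁ := toMeasurable ν ({z | ε < |u z - u x|} ∩ ball x δ₁)
  set A₂ := toMeasurable ν ({z | ε < |u z - u y|} ∩ ball y δ₂)
  have hA₁ : MeasurableSet A₁ := measurableSet_toMeasurable _ _
  have hA₂ : MeasurableSet A₂ := measurableSet_toMeasurable _ _
  have h_bad₁ := hc.measure_setOf_ofReal_le_le hA₁ hδ₁ ((measure_toMeasurable _).trans_le h_le₁)
  have h_bad₂ := hc.measure_setOf_ofReal_le_le hA₂ hδ₂ ((measure_toMeasurable _).trans_le h_le₂)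
  have h_good : ∀ᵐ ω ∂P, ¬ENNReal.ofReal δ₁ ≤ μH[1].restrict (T ω) A₁ →
      ¬ENNReal.ofReal δ₂ ≤ μH[1].restrict (T ω) A₂ → ENNReal.ofReal (|u x - u y| - 2 * ε) ≤
        liminf (fun i => ∫⁻ z in T ω, g i z ∂μH[1]) atTop := by
    filter_upwards [hu] with ω hω h₁ h₂
    exact hc.ofReal_abs_sub_sub_le_liminf hg hω hδ₁.le hδ₂.le (by linarith) hA₁ hA₂
      (subset_toMeasurable _ _) (subset_toMeasurable _ _) (not_le.1 h₁) (not_le.1 h₂)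
  refine (le_two_mul_lintegral_of_measure_le (hc.aemeasurable_liminf hg) ?_).trans
    (by grw [hc.lintegral_liminf_le hg])
  calc P {ω | ENNReal.ofReal (|u x - u y| - 2 * ε) ≤
          liminf (fun i => ∫⁻ z in T ω, g i z ∂μH[1]) atTop}ᶜ
      ≤ P ({ω | ENNReal.ofReal δ₁ ≤ μH[1].restrict (T ω) A₁} ∪
          {ω | ENNReal.ofReal δ₂ ≤ μH[1].restrict (T ω) A₂}) := by
        refine measure_mono_ae (h_good.mono fun ω hω h_notMem => ?_)
        by_contra h_union
        exact h_notMem (hω (fun h => h_union (.inl h)) fun h => h_union (.inr h))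
    _ ≤ 4⁻¹ + 4⁻¹ := (measure_union_le _ _).trans (add_le_add h_bad₁ h_bad₂)
    _ = 2⁻¹ := by
        rw [show (4 : ℝ≥0∞)⁻¹ = 2⁻¹ / 2 by
          rw [ENNReal.div_eq_inv_mul, ← ENNReal.mul_inv (by simp) (by simp)]; norm_num,
          ENNReal.add_halves]

theorem ofReal_abs_sub_le_two_mul_liminf {u : X → ℝ} {g : ℕ → X → ℝ≥0∞}
    (hg : ∀ i, Measurable (g i)) (hu : ∀ᵐ ω ∂P, IsUpperBoundAlong u g (c ω)) (hxy : x ≠ y)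
    (hx : ∀ ε > 0, HasLinearLowerDensityZeroAt ν {z | ε < |u z - u x|} x)
    (hy : ∀ ε > 0, HasLinearLowerDensityZeroAt ν {z | ε < |u z - u y|} y) :
    ENNReal.ofReal |u x - u y| ≤ 2 * liminf (fun i => ∫⁻ z, g i z ∂ν) atTop := by
  have h_lim : Tendsto (fun ε : ℝ => ENNReal.ofReal (|u x - u y| - 2 * ε)) (𝓝[>] 0)
      (𝓝 (ENNReal.ofReal |u x - u y|)) := by
    have h_cont : Continuous fun ε : ℝ => ENNReal.ofReal (|u x - u y| - 2 * ε) :=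
      ENNReal.continuous_ofReal.comp (by fun_prop)
    simpa using (h_cont.tendsto 0).mono_left nhdsWithin_le_nhds
  exact le_of_tendsto h_lim (eventually_nhdsWithin_of_forall fun ε hε =>
    hc.ofReal_abs_sub_sub_le_two_mul_liminf hg hu hxy (hx ε hε) (hy ε hε))

end IsSimplePencil

namespace IsDoublingWith

variable {μ : Measure X} {D : ℝ≥0} (hμ : IsDoublingWith μ D)
include hμ

omit [BorelSpace X] hμ in
theorem rieszPole_le_of_mem_ball {x y z : X} {δ : ℝ} (hz : z ∈ ball x δ) (hδ : δ ≤ dist x y / 2) :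
    rieszPole μ y z ≤ ENNReal.ofReal (3 / 2 * dist x y) / μ (ball y (dist x y / 2)) := by
  have hz := mem_ball.1 hz
  refine ENNReal.div_le_div (ENNReal.ofReal_le_ofReal ?_) (measure_mono (ball_subset_ball ?_))
  · linarith [dist_triangle_left y z x, dist_comm z x]
  · linarith [dist_triangle_left x y z, dist_comm z y]

omit hμ in
theorem setLIntegral_rieszPole_le_mul_measure (T : Set X) {x y : X} {δ : ℝ}
    (hδ : δ ≤ dist x y / 2) : ∫⁻ z in T ∩ ball x δ, rieszPole μ y z ∂μ ≤
      ENNReal.ofReal (3 / 2 * dist x y) / μ (ball y (dist x y / 2)) * μ (T ∩ ball x δ) := by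
  rw [← setLIntegral_const]
  exact lintegral_mono_ae (ae_restrict_of_ae_restrict_of_subset inter_subset_right
    (ae_restrict_of_forall_mem measurableSet_ball fun z hz => rieszPole_le_of_mem_ball hz hδ))

theorem hasLinearLowerDensityZeroAt_rieszMeasure {T : Set X} {x y : X} (hxy : x ≠ y)
    (hx : HasFiniteLowerDensityAt μ x) (hT : HasDensityZeroAt μ T x) (S : Set X) :
    HasLinearLowerDensityZeroAt (rieszMeasure μ S x y) T x := by
  intro θ hθ
  obtain ⟨M, hM⟩ := hx
  set d := dist x y
  have hd : 0 < d := dist_pos.2 hxy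
  set p : ℝ≥0∞ := ENNReal.ofReal (3 / 2 * d) / μ (ball y (d / 2))
  have hp_top : p ≠ ∞ := ENNReal.div_ne_top ENNReal.ofReal_ne_top (hμ.pos y (by positivity))
  obtain ⟨η, hη, hηθ⟩ := ENNReal.exists_nnreal_pos_mul_lt
    (a := D * 2 + p * M) (by finiteness) hθ.ne'
  obtain ⟨s₀, hs₀, h_density⟩ := mem_nhdsGT_iff_exists_Ioc_subset.1
    (hT η (by exact_mod_cast hη))
  refine (hM.and_eventually (Ioo_mem_nhdsGT (lt_min hs₀ (half_pos hd)))).mono ?_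
  rintro δ ⟨hδM, hδ, hδ_lt⟩
  obtain ⟨hδs, hδd⟩ := lt_min_iff.1 hδ_lt
  have h_pole_x : ∫⁻ z in T ∩ ball x δ, rieszPole μ x z ∂μ ≤ η * D * ENNReal.ofReal (2 * δ) :=
    hμ.setLIntegral_rieszPole_le x hδ fun s hs hsδ => h_density ⟨hs, hsδ.trans hδs.le⟩
  have h_δ : μ (T ∩ ball x δ) ≤ η * μ (ball x δ) := h_density ⟨hδ, hδs.le⟩
  have h_pole_y : ∫⁻ z in T ∩ ball x δ, rieszPole μ y z ∂μ ≤
      p * (η * (M * ENNReal.ofReal δ)) := by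
    grw [setLIntegral_rieszPole_le_mul_measure T hδd.le, h_δ, hδM]
  calc rieszMeasure μ S x y (T ∩ ball x δ) ≤ rieszMeasure μ univ x y (T ∩ ball x δ) :=
        rieszMeasure_mono (subset_univ S) x y _
    _ ≤ η * D * ENNReal.ofReal (2 * δ) + p * (η * (M * ENNReal.ofReal δ)) := by
        rw [hμ.rieszMeasure_apply .univ, inter_univ]
        exact add_le_add h_pole_x h_pole_y
    _ = η * (D * 2 + p * M) * ENNReal.ofReal δ := by
        rw [ENNReal.ofReal_mul zero_le_two, ENNReal.ofReal_ofNat]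
        ring
    _ ≤ θ * ENNReal.ofReal δ := by gcongr

theorem ofReal_abs_sub_le_liminf_rieszPotential {C : ℝ} (hX : SupportsUnboundedPencil μ C)
    {S : Set X} {x y : X} (hS : twoBalls C x y ⊆ S) {u : X → ℝ} {g : ℕ → X → ℝ≥0∞}
    (hg : ∀ i, Measurable (g i)) {Γ₀ : Set (RectCurve X)}
    (hu : ∀ γ, γ ∉ Γ₀ → IsUpperBoundAlong u g γ)
    (hΓ₀ : AMModulus (ENNReal.ofReal C • rieszMeasure μ S x y) Γ₀ = 0)
    (hx : HasFiniteLowerDensityAt μ x) (hux : ApproxContinuousAt μ u x)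
    (hy : HasFiniteLowerDensityAt μ y) (huy : ApproxContinuousAt μ u y) :
    ENNReal.ofReal |u x - u y| ≤ 2 * ENNReal.ofReal C *
      liminf (fun i => rieszPotential μ S (g i) x + rieszPotential μ S (g i) y) atTop := by
  rcases eq_or_ne x y with rfl | hxy
  · simp
  obtain ⟨Γ, _, σ, c, hc⟩ := hX.exists_isSimplePencil hxy hS
  have hxν (ε : ℝ) (hε : ε > 0) := (hμ.hasLinearLowerDensityZeroAt_rieszMeasure hxy hx
    (hux ε hε) S).const_smul (K := ENNReal.ofReal C) ENNReal.ofReal_ne_top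
  have hyν (ε : ℝ) (hε : ε > 0) := (hμ.hasLinearLowerDensityZeroAt_rieszMeasure hxy.symm hy
    (huy ε hε) S).const_smul (K := ENNReal.ofReal C) ENNReal.ofReal_ne_top
  simp only [rieszMeasure_comm μ S y x] at hyν
  have h_le := hc.ofReal_abs_sub_le_two_mul_liminf hg
    ((hc.ae_notMem_of_AMModulus_eq_zero hΓ₀).mono fun γ => hu (c γ)) hxy hxν hyν
  simpa only [lintegral_smul_measure, smul_eq_mul, hμ.lintegral_rieszMeasure (hg _), mul_assoc,
    ENNReal.liminf_const_mul_of_ne_top ENNReal.ofReal_ne_top] using h_le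

end IsDoublingWith

end PointwiseEstimate

section PairIntegration

theorem lintegral_prod_liminf_add_le {α : Type*} [MeasurableSpace α] {ν : Measure α}
    [IsFiniteMeasure ν] {f : ℕ → α → ℝ≥0∞} (hf : ∀ i, Measurable (f i)) :
    ∫⁻ p, liminf (fun i => f i p.1 + f i p.2) atTop ∂ν.prod ν ≤
      2 * ν univ * liminf (fun i => ∫⁻ a, f i a ∂ν) atTop := by
  have h_integral (i : ℕ) :
      ∫⁻ p, (f i p.1 + f i p.2) ∂ν.prod ν = 2 * ν univ * ∫⁻ a, f i a ∂ν := by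
    have h_fst : Measurable fun p : α × α => f i p.1 := (hf i).comp measurable_fst
    have h_snd : Measurable fun p : α × α => f i p.2 := (hf i).comp measurable_snd
    rw [lintegral_add_left h_fst, lintegral_prod _ h_fst.aemeasurable,
      lintegral_prod _ h_snd.aemeasurable]
    simp only [lintegral_const, lintegral_mul_const _ (hf i)]
    ring
  calc ∫⁻ p, liminf (fun i => f i p.1 + f i p.2) atTop ∂ν.prod ν
      ≤ liminf (fun i => ∫⁻ p, (f i p.1 + f i p.2) ∂ν.prod ν) atTop :=
        lintegral_liminf_le fun i =>
          ((hf i).comp measurable_fst).add ((hf i).comp measurable_snd)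
    _ = 2 * ν univ * liminf (fun i => ∫⁻ a, f i a ∂ν) atTop := by
        simp only [h_integral]
        exact ENNReal.liminf_const_mul_of_ne_top (by finiteness)

variable {X : Type*} [MetricSpace X] [MeasurableSpace X] {μ : Measure X}

theorem exists_AMAdmissible_liminf_lintegral_lt {Γ : Set (RectCurve X)} (hΓ : AMModulus μ Γ = 0)
    {ε : ℝ≥0∞} (hε : 0 < ε) :
    ∃ ρ ∈ AMAdmissible Γ, liminf (fun i => ∫⁻ z, ρ i z ∂μ) atTop < ε := by
  simpa only [AMModulus, iInf_lt_iff, exists_prop] using hΓ.trans_lt hε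

theorem AMModulus_smul_le {Γ : Set (RectCurve X)} {ρ : ℕ → X → ℝ≥0∞} (hρ : ρ ∈ AMAdmissible Γ)
    {c : ℝ≥0∞} (hc : c ≠ ∞) :
    AMModulus (c • μ) Γ ≤ c * liminf (fun i => ∫⁻ z, ρ i z ∂μ) atTop := by
  refine (iInf₂_le ρ hρ).trans_eq ?_
  simp only [lintegral_smul_measure, smul_eq_mul]
  exact ENNReal.liminf_const_mul_of_ne_top hc

variable [BorelSpace X]

namespace IsDoublingWith

variable {D : ℝ≥0} (hμ : IsDoublingWith μ D)
include hμ

theorem measurable_rieszPotential (S : Set X) {f : X → ℝ≥0∞} (hf : Measurable f) :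
    Measurable (rieszPotential μ S f) := by
  have := hμ.sigmaFinite
  exact (hμ.measurable_rieszPole.mul (hf.comp measurable_snd)).lintegral_prod_right'

variable (x₀ : X) {R : ℝ} (hR : 0 < R) {B S : Set X} (hB : B ⊆ ball x₀ R) (hS : S ⊆ ball x₀ R)
include hR hB hS

theorem lintegral_prod_liminf_rieszPotential_le {f : ℕ → X → ℝ≥0∞} (hf : ∀ i, Measurable (f i)) :
    ∫⁻ p, liminf (fun i => rieszPotential μ S (f i) p.1 + rieszPotential μ S (f i) p.2) atTop
        ∂(μ.restrict B).prod (μ.restrict B) ≤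
      2 * μ B * (D ^ 2 * ENNReal.ofReal (4 * R)) *
        liminf (fun i => ∫⁻ z in S, f i z ∂μ) atTop := by
  have hμB : μ B ≠ ∞ := measure_ne_top_of_subset hB (hμ.ne_top x₀ R)
  have : IsFiniteMeasure (μ.restrict B) := isFiniteMeasure_restrict.2 hμB
  have h_liminf : liminf (fun i => ∫⁻ x in B, rieszPotential μ S (f i) x ∂μ) atTop ≤
      D ^ 2 * ENNReal.ofReal (4 * R) * liminf (fun i => ∫⁻ z in S, f i z ∂μ) atTop := by
    rw [← ENNReal.liminf_const_mul_of_ne_top (by finiteness)]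
    exact liminf_le_liminf
      (.of_forall fun i => hμ.setLIntegral_rieszPotential_le x₀ hR hB hS (hf i))
  refine (lintegral_prod_liminf_add_le fun i => hμ.measurable_rieszPotential S (hf i)).trans ?_
  rw [Measure.restrict_apply_univ, mul_assoc (2 * μ B)]
  gcongr

/-- Admissible sequences with arbitrarily small `μ`-integrals have, for almost every pair of poles,
arbitrarily small integrals against the Riesz measure. -/
theorem ae_AMModulus_rieszMeasure_eq_zero {Γ : Set (RectCurve X)} (hΓ : AMModulus μ Γ = 0)
    {c : ℝ≥0∞} (hc : c ≠ ∞) :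
    ∀ᵐ p ∂(μ.restrict B).prod (μ.restrict B), AMModulus (c • rieszMeasure μ S p.1 p.2) Γ = 0 := by
  have hμB : μ B ≠ ∞ := measure_ne_top_of_subset hB (hμ.ne_top x₀ R)
  have h_pos (k : ℕ) : 0 < (k : ℝ≥0∞)⁻¹ := ENNReal.inv_pos.2 (ENNReal.natCast_ne_top k)
  choose ρ hρ hρ_lt using fun k => exists_AMAdmissible_liminf_lintegral_lt hΓ (h_pos k)
  set H : ℕ → X × X → ℝ≥0∞ := fun k p => liminf (fun i =>
    rieszPotential μ S (ρ k i) p.1 + rieszPotential μ S (ρ k i) p.2) atTop with hH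
  have h_meas : Measurable fun p => ⨅ k, H k p := .iInf fun k => .liminf fun i =>
    ((hμ.measurable_rieszPotential S ((hρ k).1 i)).comp measurable_fst).add
      ((hμ.measurable_rieszPotential S ((hρ k).1 i)).comp measurable_snd)
  have h_le (k : ℕ) : ∫⁻ p, ⨅ k, H k p ∂(μ.restrict B).prod (μ.restrict B) ≤
      2 * μ B * (D ^ 2 * ENNReal.ofReal (4 * R)) * (k : ℝ≥0∞)⁻¹ := by
    refine (lintegral_mono fun p => iInf_le _ k).trans
      ((hμ.lintegral_prod_liminf_rieszPotential_le x₀ hR hB hS (hρ k).1).trans ?_)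
    grw [← hρ_lt k]
    gcongr
    exact liminf_le_liminf (.of_forall fun i => setLIntegral_le_lintegral S _)
  have h_tendsto := ENNReal.Tendsto.const_mul (a := 2 * μ B * (D ^ 2 * ENNReal.ofReal (4 * R)))
    ENNReal.tendsto_inv_nat_nhds_zero (.inr (by finiteness))
  rw [mul_zero] at h_tendsto
  have h_zero := (lintegral_eq_zero_iff h_meas).1
    (le_antisymm (ge_of_tendsto' h_tendsto h_le) zero_le)
  filter_upwards [h_zero] with p hp
  have h_modulus (k : ℕ) : AMModulus (c • rieszMeasure μ S p.1 p.2) Γ ≤ c * H k p := by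
    refine (AMModulus_smul_le (hρ k) hc).trans_eq ?_
    simp only [hμ.lintegral_rieszMeasure ((hρ k).1 _), hH]
  refine le_antisymm ((le_iInf h_modulus).trans_eq ?_) zero_le
  rw [← ENNReal.mul_iInf fun h_top => absurd h_top hc, hp, Pi.zero_apply, mul_zero]

end IsDoublingWith

end PairIntegration

section Poincare

section Oscillation

variable {α E : Type*} [MeasurableSpace α] [NormedAddCommGroup E] {ν : Measure α}
  [IsFiniteMeasure ν] {u : α → E}

theorem integrable_of_integrable_sub (hu : Integrable (fun p : α × α => u p.1 - u p.2) (ν.prod ν)) :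
    Integrable u ν := by
  rcases eq_zero_or_neZero ν with rfl | _
  · exact integrable_zero_measure
  obtain ⟨a, ha⟩ := hu.prod_right_ae.exists
  exact ((integrable_const (u a)).sub ha).congr (.of_forall fun b => sub_sub_cancel (u a) (u b))

theorem laverage_enorm_sub_average_le [NormedSpace ℝ E] [CompleteSpace E] (hu : Integrable u ν) :
    ⨍⁻ a, ‖u a - ⨍ b, u b ∂ν‖ₑ ∂ν ≤ ⨍⁻ a, ⨍⁻ b, ‖u a - u b‖ₑ ∂ν ∂ν := by
  rcases eq_zero_or_neZero ν with rfl | _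
  · simp
  refine lintegral_mono fun a => ?_
  have h_average : u a - ⨍ b, u b ∂ν = ⨍ b, (u a - u b) ∂ν := by
    simp only [average, integral_sub (integrable_const _) hu.to_average, integral_const,
      probReal_univ, one_smul]
  rw [h_average]
  exact enorm_integral_le_lintegral_enorm _

end Oscillation

variable {X : Type*} [MetricSpace X] [MeasurableSpace X] {μ : Measure X}

namespace IsDoublingWith

variable {D : ℝ≥0} (hμ : IsDoublingWith μ D)
include hμ

theorem inv_measure_mul_liminf_setLIntegral_le (x : X) {r t : ℝ} (hr : 0 < r) (ht : 0 < t) {m : ℕ}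
    (htm : t ≤ 2 ^ m) (f : ℕ → X → ℝ≥0∞) :
    (μ (ball x r))⁻¹ * liminf (fun i => ∫⁻ z in ball x (t * r), f i z ∂μ) atTop ≤
      D ^ m * liminf (fun i => ⨍⁻ z in ball x (t * r), f i z ∂μ) atTop := by
  have h_pos : μ (ball x (t * r)) ≠ 0 := hμ.pos x (by positivity)
  have h_measure : μ (ball x (t * r)) ≤ D ^ m * μ (ball x r) :=
    (measure_mono (ball_subset_ball (by gcongr))).trans (hμ.measure_ball_two_pow_mul_le x hr m)
  have h_inv : (μ (ball x r))⁻¹ ≤ D ^ m * (μ (ball x (t * r)))⁻¹ := by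
    rw [← div_eq_mul_inv, ENNReal.le_div_iff_mul_le (.inl h_pos) (.inl (hμ.ne_top x _)),
      mul_comm, ← div_eq_mul_inv]
    exact ENNReal.div_le_of_le_mul h_measure
  simp only [setLAverage_eq', lintegral_smul_measure, smul_eq_mul,
    ENNReal.liminf_const_mul_of_ne_top (ENNReal.inv_ne_top.2 h_pos)]
  rw [← mul_assoc]
  gcongr

variable [BorelSpace X] {C : ℝ} (hX : SupportsUnboundedPencil μ C) {u : X → ℝ}
  (hu : AEMeasurable u μ) {g : ℕ → X → ℝ≥0∞} (hg : IsBVAMUpperBound μ u g)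
  (x₀ : X) {r : ℝ} (hr : 0 < r)
include hX hu hg hr

theorem ae_enorm_sub_le_liminf_rieszPotential :
    ∀ᵐ p ∂(μ.restrict (ball x₀ r)).prod (μ.restrict (ball x₀ r)),
      ‖u p.1 - u p.2‖ₑ ≤ 2 * ENNReal.ofReal C * liminf (fun i =>
        rieszPotential μ (ball x₀ ((2 * C + 1) * r)) (g i) p.1 +
          rieszPotential μ (ball x₀ ((2 * C + 1) * r)) (g i) p.2) atTop := by
  rcases subsingleton_or_nontrivial X with _ | _
  · exact .of_forall fun p => by simp [Subsingleton.elim p.1 p.2]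
  have := hμ.sigmaFinite
  obtain ⟨hg_meas, ⟨Γ₀, hΓ₀, hug⟩, -⟩ := hg
  have h_good : ∀ᵐ x ∂μ.restrict (ball x₀ r),
      dist x x₀ ≤ r ∧ HasFiniteLowerDensityAt μ x ∧ ApproxContinuousAt μ u x := by
    filter_upwards [ae_restrict_mem measurableSet_ball,
      ae_restrict_of_ae (hμ.ae_hasFiniteLowerDensityAt hX),
      ae_restrict_of_ae (hμ.ae_approxContinuousAt hu)] with x hx hx_low hx_approx
    exact ⟨(mem_ball.1 hx).le, hx_low, hx_approx⟩
  have hC := hX.1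
  filter_upwards [Measure.quasiMeasurePreserving_fst.ae h_good,
    Measure.quasiMeasurePreserving_snd.ae h_good,
    hμ.ae_AMModulus_rieszMeasure_eq_zero x₀ (by positivity)
      (ball_subset_ball (by nlinarith : r ≤ (2 * C + 1) * r)) subset_rfl hΓ₀
      ENNReal.ofReal_ne_top] with ⟨x, y⟩ ⟨hx, hx_low, hux⟩ ⟨hy, hy_low, huy⟩ h_modulus
  have h_twoBalls : twoBalls C x y ⊆ ball x₀ ((2 * C + 1) * r) :=
    (hX.twoBalls_subset_ball hx hy
      (by linarith [dist_triangle_right x y x₀] : dist x y ≤ 2 * r)).trans_eq (by ring_nf)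
  rw [Real.enorm_eq_ofReal_abs]
  exact hμ.ofReal_abs_sub_le_liminf_rieszPotential hX h_twoBalls (fun i => (hg_meas i).1) hug
    h_modulus hx_low hux hy_low huy

theorem lintegral_prod_enorm_sub_le :
    ∫⁻ p, ‖u p.1 - u p.2‖ₑ ∂(μ.restrict (ball x₀ r)).prod (μ.restrict (ball x₀ r)) ≤
      ENNReal.ofReal (16 * C * D ^ 2 * (2 * C + 1) * r) * μ (ball x₀ r) *
        liminf (fun i => ∫⁻ z in ball x₀ ((2 * C + 1) * r), g i z ∂μ) atTop := by
  have hC := hX.1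
  have h_double := hμ.lintegral_prod_liminf_rieszPotential_le x₀ (by positivity)
    (ball_subset_ball (by nlinarith : r ≤ (2 * C + 1) * r)) subset_rfl fun i => (hg.1 i).1
  refine (lintegral_mono_ae
    (hμ.ae_enorm_sub_le_liminf_rieszPotential hX hu hg x₀ hr)).trans ?_
  rw [lintegral_const_mul' _ _ (by finiteness)]
  grw [h_double]
  refine le_of_eq ?_
  have h_const : ENNReal.ofReal (16 * C * D ^ 2 * (2 * C + 1) * r) =
      4 * ENNReal.ofReal C * (D ^ 2 * ENNReal.ofReal (4 * ((2 * C + 1) * r))) := by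
    rw [← ENNReal.ofReal_ofNat, ← ENNReal.ofReal_coe_nnreal, ← ENNReal.ofReal_pow D.coe_nonneg,
      ← ENNReal.ofReal_mul (by positivity), ← ENNReal.ofReal_mul (by positivity),
      ← ENNReal.ofReal_mul (by positivity)]
    ring_nf
  rw [h_const]
  ring

theorem integrableOn_ball : IntegrableOn u (ball x₀ r) μ := by
  have : IsFiniteMeasure (μ.restrict (ball x₀ r)) := isFiniteMeasure_restrict.2 (hμ.ne_top x₀ r)
  have h_liminf : liminf (fun i => ∫⁻ z in ball x₀ ((2 * C + 1) * r), g i z ∂μ) atTop < ∞ :=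
    (liminf_le_liminf (.of_forall fun i => setLIntegral_le_lintegral _ _)).trans_lt hg.2.2
  have hu' := hu.aestronglyMeasurable.restrict (s := ball x₀ r)
  refine integrable_of_integrable_sub ⟨hu'.comp_fst.sub hu'.comp_snd, ?_⟩
  have hμ_ball := hμ.ne_top x₀ r
  exact (hμ.lintegral_prod_enorm_sub_le hX hu hg x₀ hr).trans_lt (by finiteness)

theorem setLAverage_enorm_sub_setAverage_le {m : ℕ} (hm : 2 * C + 1 ≤ 2 ^ m) :
    ⨍⁻ z in ball x₀ r, ‖u z - ⨍ w in ball x₀ r, u w ∂μ‖ₑ ∂μ ≤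
      ENNReal.ofReal (16 * C * D ^ 2 * (2 * C + 1) * r) * (D ^ m *
        liminf (fun i => ⨍⁻ z in ball x₀ ((2 * C + 1) * r), g i z ∂μ) atTop) := by
  have hC := hX.1
  have h_pos := hμ.pos x₀ hr
  have h_fin := hμ.ne_top x₀ r
  have : IsFiniteMeasure (μ.restrict (ball x₀ r)) := isFiniteMeasure_restrict.2 h_fin
  have hu' := hu.restrict (s := ball x₀ r)
  calc ⨍⁻ z in ball x₀ r, ‖u z - ⨍ w in ball x₀ r, u w ∂μ‖ₑ ∂μ
      ≤ ⨍⁻ z in ball x₀ r, ⨍⁻ w in ball x₀ r, ‖u z - u w‖ₑ ∂μ ∂μ :=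
        laverage_enorm_sub_average_le (hμ.integrableOn_ball hX hu hg x₀ hr)
    _ = (μ (ball x₀ r))⁻¹ * ((μ (ball x₀ r))⁻¹ *
          ∫⁻ p, ‖u p.1 - u p.2‖ₑ ∂(μ.restrict (ball x₀ r)).prod (μ.restrict (ball x₀ r))) := by
        have h_meas : AEMeasurable (fun p : X × X => ‖u p.1 - u p.2‖ₑ)
            ((μ.restrict (ball x₀ r)).prod (μ.restrict (ball x₀ r))) :=
          (hu'.comp_fst.sub hu'.comp_snd).enorm
        rw [lintegral_prod _ h_meas,
          ← lintegral_const_mul' _ _ (ENNReal.inv_ne_top.2 h_pos)]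
        simp only [setLAverage_eq', lintegral_smul_measure, smul_eq_mul]
    _ ≤ ENNReal.ofReal (16 * C * D ^ 2 * (2 * C + 1) * r) * ((μ (ball x₀ r))⁻¹ *
          liminf (fun i => ∫⁻ z in ball x₀ ((2 * C + 1) * r), g i z ∂μ) atTop) := by
        grw [hμ.lintegral_prod_enorm_sub_le hX hu hg x₀ hr, mul_right_comm _ (μ (ball x₀ r)),
          mul_comm _ (μ (ball x₀ r)), ENNReal.inv_mul_cancel_left h_pos h_fin]
        exact le_of_eq (by ring)
    _ ≤ _ := by
        gcongr ENNReal.ofReal _ * ?_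
        exact hμ.inv_measure_mul_liminf_setLIntegral_le x₀ hr (by positivity) hm g

end IsDoublingWith

end Poincare

theorem proposition3p6_general {X : Type*} [MetricSpace X] [MeasurableSpace X] [BorelSpace X]
    (μ : Measure X) (hμ : IsDoublingMeasure μ) {C : ℝ} (hX : SupportsUnboundedPencil μ C) :
    SupportsAMPoincare μ := by
  obtain ⟨D, hD⟩ := hμ.exists_isDoublingWith
  obtain ⟨m, hm⟩ := pow_unbounded_of_one_lt (2 * C + 1) one_lt_two
  have hC := hX.1
  refine ⟨16 * C * D ^ 2 * (2 * C + 1) * D ^ m + 1, 2 * C + 1, by positivity, by linarith,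
    fun u g hu hg x r hr => ⟨hD.integrableOn_ball hX hu hg x hr, ?_⟩⟩
  simp only [← Real.enorm_eq_ofReal_abs]
  grw [hD.setLAverage_enorm_sub_setAverage_le hX hu hg x hr hm.le, ← mul_assoc,
    ← ENNReal.ofReal_coe_nnreal, ← ENNReal.ofReal_pow D.coe_nonneg,
    ← ENNReal.ofReal_mul (by positivity)]
  gcongr ENNReal.ofReal ?_ * _
  linarith

theorem proposition3p6 {X : Type*} [MetricSpace X] [CompleteSpace X]
    [MeasurableSpace X] [BorelSpace X] (μ : Measure X) (hμ : IsDoublingMeasure μ)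
    (hX : SupportsSemmesPencil μ) : SupportsAMPoincare μ := by
  obtain ⟨C, hC⟩ := hX.exists_supportsUnboundedPencil
  exact proposition3p6_general μ hμ hC
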